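/- **Setting.** Let $\mathcal D$ be a class of finite groups. For subgroups $U\le G$, $V\le H$ and an isomorphism $\alpha\colon V\to U$ put $\Delta(U,\alpha,V)=\{(\alpha(h),h): h\in V\}\le G\times H$ (a twisted diagonal subgroup). For all $G,H\in\mathcal D$ let $\mathcal S_{G,H}$ be a set of twisted diagonal subgroups of $G\times H$ such that: $\mathcal S_{G,H}$ is closed under $G\times H$-conjugation and under taking subgroups; for $L\in\mathcal S_{G,H}$ and $M\in\mathcal S_{H,K}$ the composed relation $L*M=\{(g,k):\exists h\in H,\ (g,h)\in L,\ (h,k)\in M\}$ lies in $\mathcal S_{G,K}$; and the diagonal $\{(g,g):g\in G\}$ lies in $\mathcal S_{G,G}$. Let $I^{\mathcal S}_{G,H}$ be the set of triples $(U,\alpha,V)$ as above with $\Delta(U,\alpha,V)\in\mathcal S_{G,H}$. Let $B(G,H)$ be the Grothendieck group of finite $(G,H)$-bisets with respect to disjoint unions (a $(G,H)$-biset being the same as a $G\times H$-set via $(g,h)x=gxh^{-1}$), with the bilinear product $[X]\cdot_H[Y]=[X\times_H Y]$, and let $B^{\mathcal S}(G,H)$ be its subgroup spanned by the classes $[(G\times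 H)/L]$ with $L\in\mathcal S_{G,H}$. The product restricts to $B^{\mathcal S}(G,H)\times B^{\mathcal S}(H,K)\to B^{\mathcal S}(G,K)$ and makes $B^{\mathcal S}(G,G)$ a ring with identity $[G]$. For a commutative ring $R$ put $RB^{\mathcal S}(G,H)=R\otimes_{\mathbb Z}B^{\mathcal S}(G,H)$. Let $\mathcal T$ be a set of representatives of the isomorphism classes of finite groups. For $T\in\mathcal T$ let $\overline{\mathrm{Inj}}(T,G)$ be the set of classes $[\lambda]$ of injective homomorphisms $\lambda\colon T\to G$ modulo conjugation by $G$; it is a right $\mathrm{Out}(T)$-set via $[\lambda]\omega=[\lambda\circ\omega]$. Let $\mathrm{Hom}^{\mathcal S}_{R\mathrm{Out}(T)}(R\overline{\mathrm{Inj}}(T,H),R\overline{\mathrm{Inj}}(T,G))$ be the $R$-module of those $R\mathrm{Out}(T)$-homomorphisms $f$ of permutation modules such that, for every injective $\mu\colon T\to H$, $f([\mu])$ is in the $R$-span of the $[\lambda]$ with $(\lambda(T),\lambda\mu^{-1},\mu(T))\in I^{\mathcal S}_{G,H}$; write $\mathrm{End}^{\mathcal S}$ if $G=H$. Only finitely many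 $T$ give a non-zero module, so the direct sum of these modules over $T\in\mathcal T$ is also their product. Let $$\sigma^{\mathcal S}_{G,H,T}\colon B^{\mathcal S}(G,H)\to \mathrm{Hom}^{\mathcal S}_{\mathbb Z\mathrm{Out}(T)}(\mathbb Z\overline{\mathrm{Inj}}(T,H),\mathbb Z\overline{\mathrm{Inj}}(T,G)),\quad [X]\mapsto\Bigl([\mu]\mapsto\sum_{[\lambda]}\frac{|X^{\Delta(\lambda(T),\lambda\mu^{-1},\mu(T))}|}{|C_G(\lambda(T))|}[\lambda]\Bigr),$$ and $\sigma^{\mathcal S}_{G,H}=(\sigma^{\mathcal S}_{G,H,T})_{T\in\mathcal T}$; tensoring with $R$ gives $\sigma^{\mathcal S}_{G,H}\colon RB^{\mathcal S}(G,H)\to\bigoplus_{T}\mathrm{Hom}^{\mathcal S}_{R\mathrm{Out}(T)}(R\overline{\mathrm{Inj}}(T,H),R\overline{\mathrm{Inj}}(T,G))$. Let $\tilde B^{\mathcal S}(G,H)$ be the group of $G\times H$-fixed points (for conjugation) in the free abelian group on $I^{\mathcal S}_{G,H}$, and $\tilde B^{\mathcal S}_T(G,H)$ its direct summand of elements supported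 on triples with $U\cong T\cong V$. Let $\rho^{\mathcal S}_{G,H}\colon B^{\mathcal S}(G,H)\to\tilde B^{\mathcal S}(G,H)$, $[X]\mapsto\sum_{(U,\alpha,V)\in I^{\mathcal S}_{G,H}}\frac{|X^{\Delta(U,\alpha,V)}|}{|C_G(U)|}(U,\alpha,V)$, with components $\rho^{\mathcal S}_{G,H,T}$ in $\tilde B_T^{\mathcal S}(G,H)$. Let the product $\tilde B^{\mathcal S}_T(G,H)\times\tilde B^{\mathcal S}_T(H,K)\to\tilde B^{\mathcal S}_T(G,K)$ be the restriction of the $\mathbb Q$-bilinear product with $(U,\alpha,V)\cdot_H(V',\beta,W)=\frac{|C_H(V)|}{|H|}(U,\alpha\beta,W)$ if $V=V'$ and $0$ otherwise. Finally let $\tau^{\mathcal S}_{G,H,T}\colon\tilde B^{\mathcal S}_T(G,H)\to\mathrm{Hom}^{\mathcal S}_{\mathbb Z\mathrm{Out}(T)}(\mathbb Z\overline{\mathrm{Inj}}(T,H),\mathbb Z\overline{\mathrm{Inj}}(T,G))$, $\tau^{\mathcal S}_{G,H,T}(a)([\mu])=\sum_{[\lambda]}a_{(\lambda(T),\lambda\mu^{-1},\mu(T))}[\lambda]$.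 **Theorem.** Let $G,H,K\in\mathcal D$ and let $R$ be a commutative ring. (a) For $T\in\mathcal T$, $a\in B^{\mathcal S}(G,H)$ and $b\in B^{\mathcal S}(H,K)$ one has $\sigma^{\mathcal S}_{G,K,T}(a\cdot_H b)=\sigma^{\mathcal S}_{G,H,T}(a)\circ\sigma^{\mathcal S}_{H,K,T}(b)$. (b) The group homomorphism $\sigma^{\mathcal S}_{G,H}\colon B^{\mathcal S}(G,H)\to\bigoplus_{T}\mathrm{Hom}^{\mathcal S}_{\mathbb Z\mathrm{Out}(T)}(\mathbb Z\overline{\mathrm{Inj}}(T,H),\mathbb Z\overline{\mathrm{Inj}}(T,G))$ is injective with finite cokernel. If $|G\times H|$ is invertible in $R$, the induced $R$-module homomorphism on $RB^{\mathcal S}(G,H)$ is an isomorphism. (c) The map $\sigma^{\mathcal S}_{G,G}\colon B^{\mathcal S}(G,G)\to\prod_T\mathrm{End}^{\mathcal S}_{\mathbb Z\mathrm{Out}(T)}(\mathbb Z\overline{\mathrm{Inj}}(T,G))$ is an injective ring homomorphism with image of finite index, multiplication in the codomain being componentwise composition. If $|G|$ is invertible in $R$, the induced map $RB^{\mathcal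 S}(G,G)\to\prod_T\mathrm{End}^{\mathcal S}_{R\mathrm{Out}(T)}(R\overline{\mathrm{Inj}}(T,G))$ is an isomorphism of $R$-algebras. (d) For $T\in\mathcal T$ the map $\tau^{\mathcal S}_{G,H,T}$ is a group isomorphism and $\tau^{\mathcal S}_{G,H,T}\circ\rho^{\mathcal S}_{G,H,T}=\sigma^{\mathcal S}_{G,H,T}$; in particular $(\tau^{\mathcal S}_{G,H,T})_T\circ\rho^{\mathcal S}_{G,H}=\sigma^{\mathcal S}_{G,H}$. Moreover, for $a\in\tilde B^{\mathcal S}_T(G,H)$ and $b\in\tilde B^{\mathcal S}_T(H,K)$ the product $a\cdot_H b$ lies in $\tilde B^{\mathcal S}_T(G,K)$ and $\tau^{\mathcal S}_{G,K,T}(a\cdot_H b)=\tau^{\mathcal S}_{G,H,T}(a)\circ\tau^{\mathcal S}_{H,K,T}(b)$. -/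

import Mathlib

universe u

section Bisets

variable {G H K : Type u} [Group G] [Group H] [Group K]

/-- A finite `(G, H)`-biset, given as a finite `G × H`-set. The two-sided action is
`g x h = (g, h⁻¹) • x`; conversely `(g, h) • x = g x h⁻¹`. -/
structure Biset (G H : Type u) [Group G] [Group H] where
  carrier : Type u
  [action : MulAction (G × H) carrier]
  [finite : Finite carrier]

attribute [instance] Biset.action Biset.finite

namespace Biset

/-- Isomorphism of bisets. -/
def Iso (X Y : Biset G H) : Prop :=
  ∃ e : X.carrier ≃ Y.carrier, ∀ (p : G × H) (x : X.carrier), e (p • x) = p • e x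

theorem Iso.refl (X : Biset G H) : Iso X X := ⟨Equiv.refl _, fun _ _ => rfl⟩

theorem Iso.symm {X Y : Biset G H} : Iso X Y → Iso Y X := by
  rintro ⟨e, he⟩
  refine ⟨e.symm, fun p x => ?_⟩
  rw [Equiv.symm_apply_eq, he, Equiv.apply_symm_apply]

theorem Iso.trans {X Y Z : Biset G H} : Iso X Y → Iso Y Z → Iso X Z := by
  rintro ⟨e, he⟩ ⟨f, hf⟩
  exact ⟨e.trans f, fun p x => by simp [he, hf]⟩

/-- Isomorphism as an equivalence relation. -/
instance isoSetoid (G H : Type u) [Group G] [Group H] : Setoid (Biset G H) where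
  r := Iso
  iseqv := ⟨Iso.refl, Iso.symm, Iso.trans⟩

/-- The disjoint union (coproduct) of two bisets. -/
def coprod (X Y : Biset G H) : Biset G H := ⟨X.carrier ⊕ Y.carrier⟩

/-- The transitive biset `(G × H) / L`. -/
def coset (L : Subgroup (G × H)) [Finite G] [Finite H] : Biset G H := ⟨(G × H) ⧸ L⟩

/-- The `H`-orbit relation on `X × Y` for the action `h (x, y) = (x h⁻¹, h y)`. -/
def tensorSetoid (X : Biset G H) (Y : Biset H K) : Setoid (X.carrier × Y.carrier) where
  r a b := ∃ h : H, b = (((1, h) : G × H) • a.1, ((h, 1) : H × K) • a.2)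
  iseqv := by
    refine ⟨fun a => ⟨1, ?_⟩, ?_, ?_⟩
    · ext
      · exact (one_smul (G × H) a.1).symm
      · exact (one_smul (H × K) a.2).symm
    · rintro a b ⟨h, rfl⟩
      refine ⟨h⁻¹, ?_⟩
      ext <;> simp [smul_smul, Prod.mk_one_one]
    · rintro a b c ⟨h, rfl⟩ ⟨h', rfl⟩
      refine ⟨h' * h, ?_⟩
      ext <;> simp [smul_smul]

theorem mk_smul_comm_left {X : Type*} [MulAction (G × H) X] (g : G) (h : H) (x : X) :
    ((g, 1) : G × H) • ((1, h) : G × H) • x = ((1, h) : G × H) • ((g, 1) : G × H) • x := by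
  simp [smul_smul]

/-- The tensor product `X ×_H Y` of bisets, with `(g, k) • [x, y] = [g x, y k⁻¹]`. -/
def tensor (X : Biset G H) (Y : Biset H K) : Biset G K where
  carrier := Quotient (tensorSetoid X Y)
  action :=
    { smul := fun p => Quotient.map
        (fun a => (((p.1, 1) : G × H) • a.1, ((1, p.2) : H × K) • a.2)) (by
          rintro a b ⟨h, rfl⟩
          refine ⟨h, ?_⟩
          ext <;> simp [smul_smul])
      one_smul := by
        rintro ⟨a⟩
        refine congrArg (Quotient.mk _) ?_
        ext
        · exact one_smul (G × H) a.1
        · exact one_smul (H × K) a.2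
      mul_smul := by
        rintro p q ⟨a⟩
        refine congrArg (Quotient.mk _) ?_
        ext <;> simp [smul_smul] }
  finite := Quotient.finite _

/-- The class `x ×_H y`. -/
def tmk {X : Biset G H} {Y : Biset H K} (x : X.carrier) (y : Y.carrier) : (tensor X Y).carrier :=
  Quotient.mk (tensorSetoid X Y) (x, y)

theorem smul_tmk {X : Biset G H} {Y : Biset H K} (p : G × K) (x : X.carrier) (y : Y.carrier) :
    p • (tmk x y : (tensor X Y).carrier) = tmk (((p.1, 1) : G × H) • x) (((1, p.2) : H × K) • y) :=
  rfl

theorem tmk_eq {X : Biset G H} {Y : Biset H K} {x x' : X.carrier} {y y' : Y.carrier} :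
    (tmk x y : (tensor X Y).carrier) = tmk x' y' ↔
      ∃ h : H, x' = ((1, h) : G × H) • x ∧ y' = ((h, 1) : H × K) • y := by
  refine Quotient.eq.trans ?_
  exact ⟨fun ⟨h, e⟩ => ⟨h, congrArg Prod.fst e, congrArg Prod.snd e⟩,
    fun ⟨h, e, e'⟩ => ⟨h, Prod.ext e e'⟩⟩

theorem tmk_surj {X : Biset G H} {Y : Biset H K} (z : (tensor X Y).carrier) :
    ∃ x y, z = tmk x y := by
  obtain ⟨⟨x, y⟩, rfl⟩ := Quotient.exists_rep z
  exact ⟨x, y, rfl⟩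

/-- A criterion for isomorphism through a bijective equivariant map. -/
theorem iso_of_bijective {X Y : Biset G H} (f : X.carrier → Y.carrier)
    (hf : Function.Bijective f) (h : ∀ (p : G × H) x, f (p • x) = p • f x) : Iso X Y :=
  ⟨Equiv.ofBijective f hf, h⟩

/-- Maps out of a tensor product. -/
def tlift {X : Biset G H} {Y : Biset H K} {A : Type*} (f : X.carrier → Y.carrier → A)
    (hf : ∀ (h : H) x y, f (((1, h) : G × H) • x) (((h, 1) : H × K) • y) = f x y) :
    (tensor X Y).carrier → A :=
  Quotient.lift (fun a : X.carrier × Y.carrier => f a.1 a.2) (by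
    rintro a b ⟨h, rfl⟩
    exact (hf h a.1 a.2).symm)

@[simp] theorem tlift_tmk {X : Biset G H} {Y : Biset H K} {A : Type*}
    (f : X.carrier → Y.carrier → A)
    (hf : ∀ (h : H) x y, f (((1, h) : G × H) • x) (((h, 1) : H × K) • y) = f x y) (x y) :
    tlift f hf (tmk x y) = f x y := rfl

theorem tensor_iso {X X' : Biset G H} {Y Y' : Biset H K} :
    Iso X X' → Iso Y Y' → Iso (tensor X Y) (tensor X' Y') := by
  rintro ⟨e, he⟩ ⟨f, hf⟩
  refine iso_of_bijective
    (tlift (fun x y => (tmk (e x) (f y) : (tensor X' Y').carrier)) ?_) ⟨?_, ?_⟩ ?_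
  · intro h x y
    exact (tmk_eq.2 ⟨h, he _ _, hf _ _⟩).symm
  · intro z w hzw
    obtain ⟨x, y, rfl⟩ := tmk_surj z
    obtain ⟨x', y', rfl⟩ := tmk_surj w
    obtain ⟨h, h1, h2⟩ := tmk_eq.1 hzw
    exact tmk_eq.2 ⟨h, e.injective (h1.trans (he _ _).symm), f.injective (h2.trans (hf _ _).symm)⟩
  · intro z
    obtain ⟨x, y, rfl⟩ := tmk_surj z
    exact ⟨tmk (e.symm x) (f.symm y), by simp⟩
  · intro p z
    obtain ⟨x, y, rfl⟩ := tmk_surj z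
    simp only [smul_tmk, tlift_tmk, he, hf]

theorem coprod_iso {X X' Y Y' : Biset G H} : Iso X X' → Iso Y Y' →
    Iso (coprod X Y) (coprod X' Y') := by
  rintro ⟨e, he⟩ ⟨f, hf⟩
  refine ⟨Equiv.sumCongr e f, ?_⟩
  rintro p (x | x)
  · exact congrArg Sum.inl (he p x)
  · exact congrArg Sum.inr (hf p x)

theorem coprod_tensor (X X' : Biset G H) (Y : Biset H K) :
    Iso (coprod (tensor X Y) (tensor X' Y)) (tensor (coprod X X') Y) := by
  refine iso_of_bijective (Sum.elim
    (tlift (fun x y => (tmk (X := coprod X X') (Sum.inl x) y)) ?_)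
    (tlift (fun x y => (tmk (X := coprod X X') (Sum.inr x) y)) ?_)) ⟨?_, ?_⟩ ?_
  · intro h x y
    exact (tmk_eq (X := coprod X X') (x := Sum.inl x).2 ⟨h, rfl, rfl⟩).symm
  · intro h x y
    exact (tmk_eq (X := coprod X X') (x := Sum.inr x).2 ⟨h, rfl, rfl⟩).symm
  · rintro (z | z) (w | w) hzw <;> obtain ⟨x, y, rfl⟩ := tmk_surj z <;>
      obtain ⟨x', y', rfl⟩ := tmk_surj w <;> obtain ⟨h, h1, h2⟩ := tmk_eq.1 hzw
    · exact congrArg Sum.inl (tmk_eq.2 ⟨h, Sum.inl_injective h1, h2⟩)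
    · exact absurd h1 Sum.inr_ne_inl
    · exact absurd h1 Sum.inl_ne_inr
    · exact congrArg Sum.inr (tmk_eq.2 ⟨h, Sum.inr_injective h1, h2⟩)
  · intro z
    obtain ⟨x | x, y, rfl⟩ := tmk_surj z
    · exact ⟨Sum.inl (tmk x y), rfl⟩
    · exact ⟨Sum.inr (tmk x y), rfl⟩
  · rintro p (z | z) <;> obtain ⟨x, y, rfl⟩ := tmk_surj z <;> rfl

theorem tensor_coprod (X : Biset G H) (Y Y' : Biset H K) :
    Iso (coprod (tensor X Y) (tensor X Y')) (tensor X (coprod Y Y')) := by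
  refine iso_of_bijective (Sum.elim
    (tlift (fun x y => (tmk (Y := coprod Y Y') x (Sum.inl y))) ?_)
    (tlift (fun x y => (tmk (Y := coprod Y Y') x (Sum.inr y))) ?_)) ⟨?_, ?_⟩ ?_
  · intro h x y
    exact (tmk_eq (Y := coprod Y Y') (y := Sum.inl y).2 ⟨h, rfl, rfl⟩).symm
  · intro h x y
    exact (tmk_eq (Y := coprod Y Y') (y := Sum.inr y).2 ⟨h, rfl, rfl⟩).symm
  · rintro (z | z) (w | w) hzw <;> obtain ⟨x, y, rfl⟩ := tmk_surj z <;>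
      obtain ⟨x', y', rfl⟩ := tmk_surj w <;> obtain ⟨h, h1, h2⟩ := tmk_eq.1 hzw
    · exact congrArg Sum.inl (tmk_eq.2 ⟨h, h1, Sum.inl_injective h2⟩)
    · exact absurd h2 Sum.inr_ne_inl
    · exact absurd h2 Sum.inl_ne_inr
    · exact congrArg Sum.inr (tmk_eq.2 ⟨h, h1, Sum.inr_injective h2⟩)
  · intro z
    obtain ⟨x, y | y, rfl⟩ := tmk_surj z
    · exact ⟨Sum.inl (tmk x y), rfl⟩
    · exact ⟨Sum.inr (tmk x y), rfl⟩
  · rintro p (z | z) <;> obtain ⟨x, y, rfl⟩ := tmk_surj z <;> rfl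

theorem tensor_assoc {L : Type u} [Group L] (X : Biset G H) (Y : Biset H K) (Z : Biset K L) :
    Iso (tensor (tensor X Y) Z) (tensor X (tensor Y Z)) := by
  refine iso_of_bijective (tlift (fun w z => tlift (fun x y =>
    (tmk x (tmk y z : (tensor Y Z).carrier) : (tensor X (tensor Y Z)).carrier)) ?_ w) ?_)
    ⟨?_, ?_⟩ ?_
  · intro h x y
    have h1 : ((1, 1) : K × L) • z = z := one_smul (K × L) z
    refine (tmk_eq.2 ⟨h, rfl, ?_⟩).symm
    rw [smul_tmk, h1]
  · intro k w z
    obtain ⟨x, y, rfl⟩ := tmk_surj w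
    have h1 : ((1, 1) : G × H) • x = x := one_smul (G × H) x
    simp only [smul_tmk, tlift_tmk, h1]
    exact congrArg _ (tmk_eq.2 ⟨k, rfl, rfl⟩).symm
  · intro a b hab
    obtain ⟨w, z, rfl⟩ := tmk_surj a
    obtain ⟨w', z', rfl⟩ := tmk_surj b
    obtain ⟨x, y, rfl⟩ := tmk_surj w
    obtain ⟨x', y', rfl⟩ := tmk_surj w'
    obtain ⟨h, h1, h2⟩ := tmk_eq.1 hab
    rw [smul_tmk] at h2
    obtain ⟨k, h3, h4⟩ := tmk_eq.1 h2.symm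
    have h5 : ((1, 1) : K × L) • z = z := one_smul (K × L) z
    have h6 : ((1, 1) : G × H) • x = x := one_smul (G × H) x
    rw [h5] at h4
    refine tmk_eq.2 ⟨k, ?_, h4⟩
    rw [smul_tmk, h6]
    refine (tmk_eq.2 ⟨h, h1, ?_⟩).symm
    exact h3.trans (mk_smul_comm_left _ _ _).symm
  · intro c
    obtain ⟨x, w, rfl⟩ := tmk_surj c
    obtain ⟨y, z, rfl⟩ := tmk_surj w
    exact ⟨tmk (tmk x y) z, rfl⟩
  · intro p a
    obtain ⟨w, z, rfl⟩ := tmk_surj a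
    obtain ⟨x, y, rfl⟩ := tmk_surj w
    rfl

/-- The group `G` as a `(G, G)`-biset by left and right multiplication: `(g, h) • x = g x h⁻¹`. -/
def regular (G : Type u) [Group G] [Finite G] : Biset G G where
  carrier := G
  action :=
    { smul := fun p x => p.1 * x * p.2⁻¹
      one_smul := fun x => by
        change (1 : G) * x * (1 : G)⁻¹ = x
        simp
      mul_smul := fun p q x => by
        change (p.1 * q.1) * x * (p.2 * q.2)⁻¹ = p.1 * (q.1 * x * q.2⁻¹) * p.2⁻¹
        simp [mul_assoc] }

theorem regular_tensor [Finite G] (X : Biset G H) : Iso (tensor (regular G) X) X := by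
  have surj : ∀ z : (tensor (regular G) X).carrier, ∃ (g : G) (x : X.carrier),
      z = tmk (X := regular G) g x := fun z => tmk_surj z
  refine iso_of_bijective
    (tlift (X := regular G) (fun (g : G) x => ((g, 1) : G × H) • x) ?_) ⟨?_, ?_⟩ ?_
  · intro h (g : G) x
    change (((1 : G) * g * h⁻¹, 1) : G × H) • ((h, 1) : G × H) • x = _
    simp [smul_smul]
  · intro a b hab
    obtain ⟨g, x, rfl⟩ := surj a
    obtain ⟨g', x', rfl⟩ := surj b
    change ((g, 1) : G × H) • x = ((g', 1) : G × H) • x' at hab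
    refine tmk_eq.2 ⟨g'⁻¹ * g, ?_, ?_⟩
    · change g' = (1 : G) * g * (g'⁻¹ * g)⁻¹
      simp
    · have h2 := congrArg (fun y => ((g'⁻¹, 1) : G × H) • y) hab
      simp only [smul_smul, Prod.mk_mul_mk, inv_mul_cancel, one_mul] at h2
      rw [h2]
      exact (one_smul (G × H) x').symm
  · intro x
    exact ⟨tmk (X := regular G) (1 : G) x, one_smul (G × H) x⟩
  · intro p a
    obtain ⟨g, x, rfl⟩ := surj a
    change ((p.1 * g * (1 : G)⁻¹, 1) : G × H) • ((1, p.2) : G × H) • x =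
      p • ((g, 1) : G × H) • x
    obtain ⟨p1, p2⟩ := p
    simp [smul_smul]

theorem tensor_regular [Finite H] (X : Biset G H) : Iso (tensor X (regular H)) X := by
  have surj : ∀ z : (tensor X (regular H)).carrier, ∃ (x : X.carrier) (g : H),
      z = tmk (Y := regular H) x g := fun z => tmk_surj z
  refine iso_of_bijective
    (tlift (Y := regular H) (fun x (g : H) => ((1, g⁻¹) : G × H) • x) ?_) ⟨?_, ?_⟩ ?_
  · intro h x (g : H)
    change ((1, (h * g * (1 : H)⁻¹)⁻¹) : G × H) • ((1, h) : G × H) • x = _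
    simp [smul_smul]
  · intro a b hab
    obtain ⟨x, g, rfl⟩ := surj a
    obtain ⟨x', g', rfl⟩ := surj b
    change ((1, g⁻¹) : G × H) • x = ((1, g'⁻¹) : G × H) • x' at hab
    refine tmk_eq.2 ⟨g' * g⁻¹, ?_, ?_⟩
    · have h2 := congrArg (fun y => ((1, g') : G × H) • y) hab
      simp only [smul_smul, Prod.mk_mul_mk, mul_inv_cancel, one_mul] at h2
      rw [h2]
      exact (one_smul (G × H) x').symm
    · change g' = g' * g⁻¹ * g * (1 : H)⁻¹
      simp
  · intro x
    refine ⟨tmk (Y := regular H) x (1 : H), ?_⟩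
    change ((1, (1 : H)⁻¹) : G × H) • x = x
    rw [inv_one]
    exact one_smul (G × H) x
  · intro p a
    obtain ⟨x, g, rfl⟩ := surj a
    change ((1, ((1 : H) * g * p.2⁻¹)⁻¹) : G × H) • ((p.1, 1) : G × H) • x =
      p • ((1, g⁻¹) : G × H) • x
    obtain ⟨p1, p2⟩ := p
    simp [smul_smul]

end Biset

end Bisets

section BurnsideGroups

variable {G H K : Type u} [Group G] [Group H] [Group K]

/-- The relations `{X ⊔ Y} - {X} - {Y}` in the free abelian group on isomorphism classes. -/
def burnsideRel (G H : Type u) [Group G] [Group H] :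
    AddSubgroup (FreeAbelianGroup (Quotient (Biset.isoSetoid G H))) :=
  AddSubgroup.closure {z | ∃ X Y : Biset G H, z = FreeAbelianGroup.of ⟦X.coprod Y⟧ -
    FreeAbelianGroup.of ⟦X⟧ - FreeAbelianGroup.of ⟦Y⟧}

/-- The double Burnside group `B(G, H)`: the Grothendieck group of finite `(G, H)`-bisets. -/
abbrev BurnsideGroup (G H : Type u) [Group G] [Group H] : Type (u + 1) :=
  FreeAbelianGroup (Quotient (Biset.isoSetoid G H)) ⧸ burnsideRel G H

namespace BurnsideGroup

/-- The class `[X]` of a biset. -/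
def cls (X : Biset G H) : BurnsideGroup G H :=
  QuotientAddGroup.mk (FreeAbelianGroup.of ⟦X⟧)

theorem cls_eq {X Y : Biset G H} (h : X.Iso Y) : cls X = cls Y :=
  congrArg (fun q => (QuotientAddGroup.mk (FreeAbelianGroup.of q) : BurnsideGroup G H))
    (Quotient.sound h)

theorem cls_coprod (X Y : Biset G H) : cls (X.coprod Y) = cls X + cls Y := by
  have h : FreeAbelianGroup.of ⟦X.coprod Y⟧ - FreeAbelianGroup.of ⟦X⟧ -
      FreeAbelianGroup.of ⟦Y⟧ ∈ burnsideRel G H :=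
    AddSubgroup.subset_closure ⟨X, Y, rfl⟩
  have h2 := (QuotientAddGroup.eq_zero_iff _).2 h
  rw [sub_sub, QuotientAddGroup.mk_sub, sub_eq_zero] at h2
  exact h2

/-- An isomorphism invariant that is additive on disjoint unions extends to `B(G, H)`. -/
def lift {A : Type*} [AddCommGroup A] (f : Biset G H → A)
    (hiso : ∀ X Y, Biset.Iso X Y → f X = f Y) (hadd : ∀ X Y, f (X.coprod Y) = f X + f Y) :
    BurnsideGroup G H →+ A :=
  QuotientAddGroup.lift (burnsideRel G H)
    (FreeAbelianGroup.lift (Quotient.lift f fun X Y h => hiso X Y h)) (by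
      refine (AddSubgroup.closure_le _).2 ?_
      rintro z ⟨X, Y, rfl⟩
      simp [hadd])

@[simp] theorem lift_cls {A : Type*} [AddCommGroup A] (f : Biset G H → A)
    (hiso : ∀ X Y, Biset.Iso X Y → f X = f Y) (hadd : ∀ X Y, f (X.coprod Y) = f X + f Y)
    (X : Biset G H) : lift f hiso hadd (cls X) = f X := by
  change FreeAbelianGroup.lift _ (FreeAbelianGroup.of _) = _
  simp

theorem induction {p : BurnsideGroup G H → Prop} (h0 : p 0) (hc : ∀ X, p (cls X))
    (hneg : ∀ a, p a → p (-a)) (hadd : ∀ a b, p a → p b → p (a + b)) (a : BurnsideGroup G H) :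
    p a := by
  obtain ⟨z, rfl⟩ := QuotientAddGroup.mk_surjective a
  induction z using FreeAbelianGroup.induction_on with
  | zero => exact h0
  | of q =>
    obtain ⟨X, rfl⟩ := Quotient.exists_rep q
    exact hc X
  | neg q hq => exact hneg _ hq
  | add y z hy hz => exact hadd _ _ hy hz

/-- The bilinear map `[X] ·_H [Y] = [X ×_H Y]`. -/
def mul : BurnsideGroup G H →+ BurnsideGroup H K →+ BurnsideGroup G K :=
  lift (fun X => lift (fun Y => cls (X.tensor Y))
      (fun _ _ h => cls_eq (Biset.tensor_iso (Biset.Iso.refl X) h))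
      (fun Y Y' => (cls_eq (Biset.tensor_coprod X Y Y')).symm.trans (cls_coprod _ _)))
    (by
      intro X X' h
      refine AddMonoidHom.ext fun a => ?_
      induction a using induction with
      | h0 => simp
      | hc Y => simpa using cls_eq (Biset.tensor_iso h (Biset.Iso.refl Y))
      | hneg a ha => rw [map_neg, map_neg, ha]
      | hadd a b ha hb => rw [map_add, map_add, ha, hb])
    (by
      intro X X'
      refine AddMonoidHom.ext fun a => ?_
      induction a using induction with
      | h0 => simp
      | hc Y =>
        simpa using (cls_eq (Biset.coprod_tensor X X' Y)).symm.trans (cls_coprod _ _)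
      | hneg a ha => rw [map_neg, map_neg, ha]
      | hadd a b ha hb => rw [map_add, map_add, ha, hb])

@[simp] theorem mul_cls (X : Biset G H) (Y : Biset H K) :
    mul (cls X) (cls Y) = cls (X.tensor Y) := by
  simp [mul]

theorem mul_assoc' {L : Type u} [Group L] (a : BurnsideGroup G H) (b : BurnsideGroup H K)
    (c : BurnsideGroup K L) : mul (mul a b) c = mul a (mul b c) := by
  induction a using induction with
  | h0 => simp
  | hneg a ha => simp only [map_neg, AddMonoidHom.neg_apply, ha]
  | hadd a a' ha hb => simp only [map_add, AddMonoidHom.add_apply, ha, hb]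
  | hc X =>
  induction b using induction with
  | h0 => simp
  | hneg a ha => simp only [map_neg, AddMonoidHom.neg_apply, ha]
  | hadd a a' ha hb => simp only [map_add, AddMonoidHom.add_apply, ha, hb]
  | hc Y =>
  induction c using induction with
  | h0 => simp
  | hneg a ha => simp only [map_neg, ha]
  | hadd a a' ha hb => simp only [map_add, ha, hb]
  | hc Z => simpa using cls_eq (Biset.tensor_assoc X Y Z)

theorem one_mul' [Finite G] (a : BurnsideGroup G H) : mul (cls (Biset.regular G)) a = a := by
  induction a using induction with
  | h0 => simp
  | hneg a ha => simp [ha]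
  | hadd a a' ha hb => simp [ha, hb]
  | hc X => simpa using cls_eq (Biset.regular_tensor X)

theorem mul_one' [Finite H] (a : BurnsideGroup G H) : mul a (cls (Biset.regular H)) = a := by
  induction a using induction with
  | h0 => simp
  | hneg a ha => simp [ha]
  | hadd a a' ha hb => simp [ha, hb]
  | hc X => simpa using cls_eq (Biset.tensor_regular X)

/-- The mark `Φ_L : B(G, H) → ℤ`, `[X] ↦ |X^L|`. -/
noncomputable def mark (L : Subgroup (G × H)) : BurnsideGroup G H →+ ℤ :=
  lift (fun X => (Nat.card (MulAction.fixedPoints L X.carrier) : ℤ))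
    (by
      rintro X Y ⟨e, he⟩
      refine congrArg Nat.cast (Nat.card_congr (e.subtypeEquiv fun x => ?_))
      refine forall_congr' fun p => ?_
      exact (e.injective.eq_iff (a := p.1 • x)).symm.trans (by rw [he]; rfl))
    (by
      intro X Y
      rw [← Nat.cast_add, ← Nat.card_sum]
      refine congrArg Nat.cast (Nat.card_congr ?_)
      refine (Equiv.subtypeSum).trans (Equiv.sumCongr
        (Equiv.subtypeEquivRight fun x => ?_) (Equiv.subtypeEquivRight fun x => ?_))
      · exact forall_congr' fun p => Sum.inl_injective.eq_iff (a := p • x)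
      · exact forall_congr' fun p => Sum.inr_injective.eq_iff (a := p • x))

@[simp] theorem mark_cls (L : Subgroup (G × H)) (X : Biset G H) :
    mark L (cls X) = Nat.card (MulAction.fixedPoints L X.carrier) := lift_cls _ _ _ X

theorem mark_conj (L : Subgroup (G × H)) (p : G × H) (a : BurnsideGroup G H) :
    mark (L.map (MulAut.conj p).toMonoidHom) a = mark L a := by
  induction a using induction with
  | h0 => simp
  | hneg a ha => rw [map_neg, map_neg, ha]
  | hadd a a' ha hb => rw [map_add, map_add, ha, hb]
  | hc X =>
    rw [mark_cls, mark_cls]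
    refine congrArg Nat.cast (Nat.card_congr
      ((MulAction.toPerm p : Equiv.Perm X.carrier).subtypeEquiv fun x => ?_).symm)
    constructor
    · rintro h ⟨_, q, hq, rfl⟩
      change (p * q * p⁻¹) • p • x = p • x
      rw [smul_smul, inv_mul_cancel_right, mul_smul]
      exact congrArg (p • ·) (h ⟨q, hq⟩)
    · rintro h ⟨q, hq⟩
      have h1 := h ⟨_, q, hq, rfl⟩
      change (p * q * p⁻¹) • p • x = p • x at h1
      rw [smul_smul, inv_mul_cancel_right, mul_smul] at h1
      exact smul_left_cancel p h1

/-- If the left action is free then `|C|` divides the number of fixed points of `L`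
whenever `C × 1` centralizes `L`. -/
theorem card_dvd_mark_cls (X : Biset G H) (hX : ∀ (g : G) (x : X.carrier),
    ((g, 1) : G × H) • x = x → g = 1) (L : Subgroup (G × H)) (C : Subgroup G)
    (hC : ∀ g ∈ C, ∀ p ∈ L, ((g, 1) : G × H) * p = p * (g, 1)) :
    (Nat.card C : ℤ) ∣ mark L (cls X) := by
  rw [mark_cls]
  let act : MulAction C (MulAction.fixedPoints L X.carrier) :=
    { smul := fun c x => ⟨((c.1, 1) : G × H) • x.1, fun p => by
        change p.1 • ((c.1, 1) : G × H) • x.1 = ((c.1, 1) : G × H) • x.1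
        rw [smul_smul, ← hC c.1 c.2 p.1 p.2, mul_smul]
        exact congrArg _ (x.2 p)⟩
      one_smul := fun x => Subtype.ext (one_smul (G × H) x.1)
      mul_smul := fun c d x => Subtype.ext (by
        change ((c.1 * d.1, 1) : G × H) • x.1 = ((c.1, 1) : G × H) • ((d.1, 1) : G × H) • x.1
        simp [smul_smul]) }
  have h := MulAction.selfEquivOrbitsQuotientProd (G := C)
    (X := MulAction.fixedPoints L X.carrier) (fun x => by
      rw [eq_bot_iff]
      intro c hc
      exact Subtype.ext (hX c.1 x.1 (congrArg Subtype.val hc)))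
  rw [Nat.card_congr h, Nat.card_prod, Nat.cast_mul]
  exact Dvd.intro_left _ rfl

theorem cls_eq_zero (X : Biset G H) [IsEmpty X.carrier] : cls X = 0 := by
  have h : cls X = cls (X.coprod X) := cls_eq
    ⟨⟨fun x => isEmptyElim x, fun x => by rcases x with x | x <;> exact isEmptyElim x,
      fun x => isEmptyElim x, fun x => by rcases x with x | x <;> exact isEmptyElim x⟩,
      fun p x => isEmptyElim x⟩
  rw [cls_coprod] at h
  simpa using h

/-- Splitting off one orbit. -/
theorem exists_split [Finite G] [Finite H] (X : Biset G H) (x : X.carrier) :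
    ∃ Y : Biset G H, cls X = cls (Biset.coset (MulAction.stabilizer (G × H) x)) + cls Y ∧
      Nat.card Y.carrier < Nat.card X.carrier ∧
      ∀ y : Y.carrier, ∃ z : X.carrier,
        MulAction.stabilizer (G × H) y = MulAction.stabilizer (G × H) z := by
  let act : MulAction (G × H) {y : X.carrier // y ∉ MulAction.orbit (G × H) x} :=
    { smul := fun p y => ⟨p • y.1, fun h => y.2 (by
        rw [← MulAction.orbit_eq_iff, MulAction.orbit_smul] at h
        exact MulAction.orbit_eq_iff.1 h)⟩
      one_smul := fun y => Subtype.ext (one_smul _ y.1)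
      mul_smul := fun p q y => Subtype.ext (mul_smul p q y.1) }
  let Y : Biset G H := { carrier := {y : X.carrier // y ∉ MulAction.orbit (G × H) x} }
  refine ⟨Y, ?_, ?_, ?_⟩
  · rw [← cls_coprod]
    refine (cls_eq (Biset.iso_of_bijective (Sum.elim
      (MulAction.ofQuotientStabilizer (G × H) x) Subtype.val) ⟨?_, ?_⟩ ?_)).symm
    · refine Function.Injective.sumElim (MulAction.injective_ofQuotientStabilizer (G × H) x)
        Subtype.val_injective ?_
      intro q y h
      obtain ⟨p, rfl⟩ := QuotientGroup.mk_surjective q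
      exact y.2 ⟨p, h⟩
    · intro y
      by_cases hy : y ∈ MulAction.orbit (G × H) x
      · obtain ⟨p, hp⟩ := hy
        exact ⟨Sum.inl (QuotientGroup.mk p), hp⟩
      · exact ⟨Sum.inr ⟨y, hy⟩, rfl⟩
    · rintro p (q | y)
      · exact MulAction.ofQuotientStabilizer_smul (G × H) x p q
      · rfl
  · exact Finite.card_subtype_lt (x := x) (by simp)
  · intro y
    refine ⟨y.1, ?_⟩
    ext p
    exact Subtype.ext_iff

end BurnsideGroup

end BurnsideGroups

section Triples

variable {G H K : Type u} [Group G] [Group H] [Group K]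

/-- The set `I_{G,H}` of triples `(U, α, V)` with `U ≤ G`, `V ≤ H` and `α : V → U` an
isomorphism. -/
structure IsoTriple (G H : Type u) [Group G] [Group H] where
  U : Subgroup G
  V : Subgroup H
  α : V ≃* U

namespace IsoTriple

/-- The twisted diagonal subgroup `Δ(U, α, V) = {(α(h), h) | h ∈ V}`. -/
def graph (t : IsoTriple G H) : Subgroup (G × H) :=
  ((t.U.subtype.comp t.α.toMonoidHom).prod t.V.subtype).range

theorem mem_graph {t : IsoTriple G H} {p : G × H} :
    p ∈ t.graph ↔ ∃ h : t.V, ((t.α h : G), (h : H)) = p := Iff.rfl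

theorem graph_injective : Function.Injective (graph : IsoTriple G H → Subgroup (G × H)) := by
  rintro ⟨U, V, α⟩ ⟨U', V', α'⟩ h
  have key : ∀ (U U' : Subgroup G) (V V' : Subgroup H) (α : V ≃* U) (α' : V' ≃* U'),
      graph ⟨U, V, α⟩ = graph ⟨U', V', α'⟩ → U ≤ U' ∧ V ≤ V' := by
    intro U U' V V' α α' h
    constructor
    · intro g hg
      have h1 : ((g, (α.symm ⟨g, hg⟩ : H)) : G × H) ∈ graph ⟨U, V, α⟩ :=
        ⟨α.symm ⟨g, hg⟩, by simp⟩
      rw [h] at h1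
      obtain ⟨y, hy⟩ := mem_graph.1 h1
      obtain rfl : ((α' y : U') : G) = g := congrArg Prod.fst hy
      exact (α' y).2
    · intro x hx
      have h1 : (((α ⟨x, hx⟩ : G), x) : G × H) ∈ graph ⟨U, V, α⟩ := ⟨⟨x, hx⟩, rfl⟩
      rw [h] at h1
      obtain ⟨y, hy⟩ := mem_graph.1 h1
      obtain rfl : ((y : V') : H) = x := congrArg Prod.snd hy
      exact y.2
  obtain rfl := le_antisymm (key _ _ _ _ _ _ h).1 (key _ _ _ _ _ _ h.symm).1
  obtain rfl := le_antisymm (key _ _ _ _ _ _ h).2 (key _ _ _ _ _ _ h.symm).2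
  congr 1
  ext x
  have h1 : (((α x : G), (x : H)) : G × H) ∈ graph ⟨U, V, α⟩ := ⟨x, rfl⟩
  rw [h] at h1
  obtain ⟨y, hy⟩ := mem_graph.1 h1
  obtain rfl : y = x := Subtype.ext (congrArg Prod.snd hy)
  exact (congrArg Prod.fst hy).symm

instance [Finite G] [Finite H] : Finite (IsoTriple G H) :=
  Finite.of_injective _ graph_injective

/-- The conjugation action `^{(g,h)}(U, α, V) = (gUg⁻¹, c_g α c_h⁻¹, hVh⁻¹)`. -/
instance : SMul (G × H) (IsoTriple G H) where
  smul p t :=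
    { U := t.U.map (MulAut.conj p.1).toMonoidHom
      V := t.V.map (MulAut.conj p.2).toMonoidHom
      α := ((MulAut.conj p.2).subgroupMap t.V).symm.trans
        (t.α.trans ((MulAut.conj p.1).subgroupMap t.U)) }

theorem graph_smul (p : G × H) (t : IsoTriple G H) :
    (p • t).graph = t.graph.map (MulAut.conj p).toMonoidHom := by
  ext q
  constructor
  · rintro ⟨x, rfl⟩
    obtain ⟨y, rfl⟩ := ((MulAut.conj p.2).subgroupMap t.V).surjective x
    refine ⟨((t.α y : G), (y : H)), ⟨y, rfl⟩, ?_⟩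
    change _ = (((((MulAut.conj p.1).subgroupMap t.U)
      (t.α (((MulAut.conj p.2).subgroupMap t.V).symm
        (((MulAut.conj p.2).subgroupMap t.V) y)))) : G), _)
    rw [MulEquiv.symm_apply_apply]
    rfl
  · rintro ⟨_, ⟨y, rfl⟩, rfl⟩
    refine ⟨((MulAut.conj p.2).subgroupMap t.V) y, ?_⟩
    change (((((MulAut.conj p.1).subgroupMap t.U)
      (t.α (((MulAut.conj p.2).subgroupMap t.V).symm
        (((MulAut.conj p.2).subgroupMap t.V) y)))) : G), _) = _
    rw [MulEquiv.symm_apply_apply]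
    rfl

instance : MulAction (G × H) (IsoTriple G H) where
  one_smul t := graph_injective (by
    rw [graph_smul, map_one]
    exact Subgroup.map_id _)
  mul_smul p q t := graph_injective (by
    rw [graph_smul, graph_smul, graph_smul, map_mul, Subgroup.map_map]
    rfl)

/-- The triple `(U, αβ, W)` obtained from `(U, α, V)` and `(V', β, W)` with `V = V'`. -/
def comp (t : IsoTriple G H) (s : IsoTriple H K) (h : t.V = s.U) : IsoTriple G K :=
  ⟨t.U, s.V, s.α.trans ((MulEquiv.subgroupCongr h.symm).trans t.α)⟩

end IsoTriple

/-- The product `L * M`: composition of `L` and `M` as relations. -/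
def starProd (L : Subgroup (G × H)) (M : Subgroup (H × K)) : Subgroup (G × K) where
  carrier := {p | ∃ h : H, (p.1, h) ∈ L ∧ (h, p.2) ∈ M}
  one_mem' := ⟨1, L.one_mem, M.one_mem⟩
  mul_mem' := by
    rintro p q ⟨h, h1, h2⟩ ⟨h', h1', h2'⟩
    exact ⟨h * h', L.mul_mem h1 h1', M.mul_mem h2 h2'⟩
  inv_mem' := by
    rintro p ⟨h, h1, h2⟩
    exact ⟨h⁻¹, L.inv_mem h1, M.inv_mem h2⟩

/-- The diagonal subgroup `Δ(G)` of `G × G`. -/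
def diagSubgroup (G : Type u) [Group G] : Subgroup (G × G) :=
  ((MonoidHom.id G).prod (MonoidHom.id G)).range

end Triples

section Systems

variable {ι : Type*} {Gr : ι → Type u} [∀ i, Group (Gr i)]

/-- A system `𝒮` of sets `𝒮_{G,H}` of twisted diagonal subgroups of `G × H`, for `G, H` in a
family of groups, which is closed under conjugation, under taking subgroups and under the
product `*`, and which contains all diagonals `Δ(G)`. -/
structure BifreeSystem (Gr : ι → Type u) [∀ i, Group (Gr i)] where
  mem : ∀ i j, Set (Subgroup (Gr i × Gr j))
  twisted : ∀ {i j} {L : Subgroup (Gr i × Gr j)}, L ∈ mem i j → ∃ t : IsoTriple _ _, t.graph = L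
  conj : ∀ {i j} {L : Subgroup (Gr i × Gr j)}, L ∈ mem i j → ∀ p : Gr i × Gr j,
    L.map (MulAut.conj p).toMonoidHom ∈ mem i j
  sub : ∀ {i j} {L M : Subgroup (Gr i × Gr j)}, L ∈ mem i j → M ≤ L → M ∈ mem i j
  star : ∀ {i j k} {L : Subgroup (Gr i × Gr j)} {M : Subgroup (Gr j × Gr k)},
    L ∈ mem i j → M ∈ mem j k → starProd L M ∈ mem i k
  diag : ∀ i, diagSubgroup (Gr i) ∈ mem i i

namespace BifreeSystem

variable {S : BifreeSystem Gr}

theorem conj_iff {i j : ι} {L : Subgroup (Gr i × Gr j)} (p : Gr i × Gr j) :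
    L.map (MulAut.conj p).toMonoidHom ∈ S.mem i j ↔ L ∈ S.mem i j := by
  refine ⟨fun h => ?_, fun h => S.conj h p⟩
  have h1 := S.conj h p⁻¹
  rw [Subgroup.map_map] at h1
  convert h1
  ext q
  constructor
  · intro hq
    refine ⟨q, hq, ?_⟩
    change p⁻¹ * (p * q * p⁻¹) * p⁻¹⁻¹ = q
    group
  · rintro ⟨r, hr, rfl⟩
    change p⁻¹ * (p * r * p⁻¹) * p⁻¹⁻¹ ∈ L
    have h2 : p⁻¹ * (p * r * p⁻¹) * p⁻¹⁻¹ = r := by group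
    rw [h2]
    exact hr

theorem fst_eq_one {i j : ι} {L : Subgroup (Gr i × Gr j)} (hL : L ∈ S.mem i j) {g : Gr i}
    (hg : (g, 1) ∈ L) : g = 1 := by
  obtain ⟨t, rfl⟩ := S.twisted hL
  obtain ⟨h, hh⟩ := IsoTriple.mem_graph.1 hg
  have h1 : h = 1 := Subtype.ext (congrArg Prod.snd hh)
  have h2 := congrArg Prod.fst hh
  rw [h1, map_one] at h2
  exact h2.symm

variable [∀ i, Finite (Gr i)] (S)

open BurnsideGroup

/-- The subgroup `B^𝒮(G, H)` of `B(G, H)` spanned by the `[G × H / L]` with `L ∈ 𝒮_{G,H}`. -/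
def burnside (i j : ι) : Submodule ℤ (BurnsideGroup (Gr i) (Gr j)) :=
  Submodule.span ℤ {a | ∃ L ∈ S.mem i j, a = cls (Biset.coset L)}

variable {S}

theorem cls_mem {i j : ι} (X : Biset (Gr i) (Gr j))
    (h : ∀ x : X.carrier, MulAction.stabilizer (Gr i × Gr j) x ∈ S.mem i j) :
    cls X ∈ S.burnside i j := by
  induction hn : Nat.card X.carrier using Nat.strong_induction_on generalizing X with
  | _ n ih =>
  rcases isEmpty_or_nonempty X.carrier with hX | ⟨⟨x⟩⟩
  · rw [cls_eq_zero]
    exact Submodule.zero_mem _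
  · obtain ⟨Y, h1, h2, h3⟩ := exists_split X x
    rw [h1]
    refine Submodule.add_mem _ (Submodule.subset_span ⟨_, h x, rfl⟩)
      (ih _ (hn ▸ h2) Y (fun y => ?_) rfl)
    obtain ⟨z, hz⟩ := h3 y
    rw [hz]
    exact h z

theorem stabilizer_coset {i j : ι} {L : Subgroup (Gr i × Gr j)} (hL : L ∈ S.mem i j)
    (x : (Biset.coset L).carrier) : MulAction.stabilizer (Gr i × Gr j) x ∈ S.mem i j := by
  obtain ⟨p, rfl⟩ := QuotientGroup.mk_surjective (x : (Gr i × Gr j) ⧸ L)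
  refine S.sub (S.conj hL p) fun q hq => ?_
  have h1 : (QuotientGroup.mk (q * p) : (Gr i × Gr j) ⧸ L) = QuotientGroup.mk p := hq
  have h2 := QuotientGroup.eq.1 h1.symm
  refine ⟨_, h2, ?_⟩
  change p * (p⁻¹ * (q * p)) * p⁻¹ = q
  group

theorem mul_mem {i j k : ι} {a : BurnsideGroup (Gr i) (Gr j)} {b : BurnsideGroup (Gr j) (Gr k)}
    (ha : a ∈ S.burnside i j) (hb : b ∈ S.burnside j k) : mul a b ∈ S.burnside i k := by
  induction ha using Submodule.span_induction with
  | zero => simp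
  | add x y _ _ hx hy =>
    rw [map_add]
    exact Submodule.add_mem _ hx hy
  | smul n x _ hx =>
    rw [map_zsmul]
    exact Submodule.smul_mem _ n hx
  | mem a ha =>
  obtain ⟨L, hL, rfl⟩ := ha
  induction hb using Submodule.span_induction with
  | zero => simp
  | add x y _ _ hx hy =>
    rw [map_add]
    exact Submodule.add_mem _ hx hy
  | smul n x _ hx =>
    rw [map_zsmul]
    exact Submodule.smul_mem _ n hx
  | mem b hb =>
  obtain ⟨M, hM, rfl⟩ := hb
  rw [mul_cls]
  refine cls_mem _ fun z => ?_
  obtain ⟨x, y, rfl⟩ := Biset.tmk_surj z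
  refine S.sub (S.star (stabilizer_coset hL x) (stabilizer_coset hM y)) fun p hp => ?_
  obtain ⟨h, h1, h2⟩ := Biset.tmk_eq.1 ((Biset.smul_tmk p x y).symm.trans hp)
  refine ⟨h, ?_, ?_⟩
  · rw [MulAction.mem_stabilizer_iff]
    refine Eq.trans ?_ h1.symm
    simp [smul_smul]
  · rw [MulAction.mem_stabilizer_iff]
    refine Eq.trans ?_ h2.symm
    simp [smul_smul]

theorem one_mem (i : ι) : cls (Biset.regular (Gr i)) ∈ S.burnside i i := by
  refine cls_mem _ fun (x : Gr i) => ?_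
  refine S.sub (S.conj (S.diag i) (x, 1)) fun p hp => ?_
  have h1 : p.1 * x * p.2⁻¹ = x := hp
  refine ⟨(p.2, p.2), ⟨p.2, rfl⟩, ?_⟩
  have h2 : p.1 * x = x * p.2 := by
    rw [mul_inv_eq_iff_eq_mul] at h1
    exact h1
  refine Prod.ext ?_ ?_
  · change x * p.2 * x⁻¹ = p.1
    rw [← h2, mul_inv_cancel_right]
  · change 1 * p.2 * 1⁻¹ = p.2
    simp

variable (S)

/-- The product `B^𝒮(G, H) × B^𝒮(H, K) → B^𝒮(G, K)`, the restriction of the biset product. -/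
def bmul {i j k : ι} (a : S.burnside i j) (b : S.burnside j k) : S.burnside i k :=
  ⟨mul a.1 b.1, mul_mem a.2 b.2⟩

/-- The ring `B^𝒮(G, G)`, with identity element `[G]`. -/
instance burnsideRing (i : ι) : Ring (S.burnside i i) :=
  { (inferInstance : AddCommGroup (S.burnside i i)) with
    mul := fun a b => S.bmul a b
    one := ⟨cls (Biset.regular (Gr i)), one_mem i⟩
    mul_assoc := fun a b c => Subtype.ext (mul_assoc' a.1 b.1 c.1)
    one_mul := fun a => Subtype.ext (one_mul' a.1)
    mul_one := fun a => Subtype.ext (mul_one' a.1)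
    left_distrib := fun a b c => Subtype.ext (map_add (mul a.1) b.1 c.1)
    right_distrib := fun a b c => Subtype.ext (by
      change mul (a.1 + b.1) c.1 = mul a.1 c.1 + mul b.1 c.1
      simp)
    zero_mul := fun a => Subtype.ext (by
      change mul 0 a.1 = 0
      simp)
    mul_zero := fun a => Subtype.ext (map_zero (mul a.1)) }

end BifreeSystem

end Systems

section Injections

variable (T G H : Type u) [Group T] [Group G] [Group H]

/-- The set of injective group homomorphisms `T → G`. -/
def Inj : Type u := {f : T →* G // Function.Injective f}

variable {T G H}

instance [Finite T] [Finite G] : Finite (Inj T G) :=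
  Finite.of_injective (fun f : Inj T G => (f.1 : T → G)) fun _ _ h =>
    Subtype.ext (DFunLike.coe_injective h)

/-- `G` acts on `Inj(T, G)` by `g λ = c_g ∘ λ`. -/
instance : MulAction G (Inj T G) where
  smul g f := ⟨(MulAut.conj g).toMonoidHom.comp f.1, (MulAut.conj g).injective.comp f.2⟩
  one_smul f := Subtype.ext (MonoidHom.ext fun t => by
    change 1 * f.1 t * 1⁻¹ = f.1 t
    simp)
  mul_smul g g' f := Subtype.ext (MonoidHom.ext fun t => by
    change g * g' * f.1 t * (g * g')⁻¹ = g * (g' * f.1 t * g'⁻¹) * g⁻¹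
    group)

theorem Inj.smul_apply (g : G) (f : Inj T G) (t : T) : (g • f).1 t = g * f.1 t * g⁻¹ := rfl

/-- The composite `λ ∘ ω` of an injection and an automorphism of `T`. -/
def Inj.comp (f : Inj T G) (ω : MulAut T) : Inj T G :=
  ⟨f.1.comp ω.toMonoidHom, f.2.comp ω.injective⟩

variable (T G) in
/-- The set of `G`-orbits `[λ]` of injective homomorphisms `λ : T → G`. -/
abbrev InjBar : Type u := MulAction.orbitRel.Quotient G (Inj T G)

/-- The orbit `[λ]`. -/
def Inj.bar (f : Inj T G) : InjBar T G := Quotient.mk _ f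

theorem Inj.bar_eq {f f' : Inj T G} : f.bar = f'.bar ↔ ∃ g : G, g • f' = f :=
  Quotient.eq.trans MulAction.orbitRel_apply

theorem InjBar.exists_rep (q : InjBar T G) : ∃ f : Inj T G, f.bar = q := Quotient.exists_rep q

variable (T) in
/-- The group of inner automorphisms of `T`. -/
def innSubgroup : Subgroup (MulAut T) := (MulAut.conj : T →* MulAut T).range

instance : (innSubgroup T).Normal where
  conj_mem := by
    rintro _ ⟨t, rfl⟩ ω
    refine ⟨ω t, MulEquiv.ext fun x => ?_⟩
    change ω t * x * (ω t)⁻¹ = ω (t * ω⁻¹ x * t⁻¹)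
    simp

variable (T) in
/-- The group `Out(T) = Aut(T) / Inn(T)`. -/
abbrev OutGroup : Type u := MulAut T ⧸ innSubgroup T

/-- The right action `[λ] ω = [λ ∘ ω]` of `Out(T)` on the set of `G`-orbits of injections. -/
instance : MulAction (OutGroup T)ᵐᵒᵖ (InjBar T G) where
  smul o q := Quotient.liftOn₂ o.unop q (fun ω f => (f.comp ω).bar) (by
    intro ω f ω' f' h1 h2
    obtain ⟨g, rfl⟩ := MulAction.orbitRel_apply.1 h2
    obtain ⟨t, ht⟩ := QuotientGroup.leftRel_apply.1 h1
    have h3 : ω' = ω * MulAut.conj t := by rw [ht, mul_inv_cancel_left]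
    rw [Inj.bar_eq]
    refine ⟨g * (f'.1 (ω t))⁻¹, Subtype.ext (MonoidHom.ext fun x => ?_)⟩
    subst h3
    change g * (f'.1 (ω t))⁻¹ * f'.1 (ω (t * x * t⁻¹)) * (g * (f'.1 (ω t))⁻¹)⁻¹ =
      g * f'.1 (ω x) * g⁻¹
    simp only [map_mul, map_inv]
    group)
  one_smul q := by
    obtain ⟨f, rfl⟩ := q.exists_rep
    rfl
  mul_smul o o' q := by
    obtain ⟨f, rfl⟩ := q.exists_rep
    obtain ⟨o, rfl⟩ := MulOpposite.op_surjective o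
    obtain ⟨o', rfl⟩ := MulOpposite.op_surjective o'
    obtain ⟨ω, rfl⟩ := QuotientGroup.mk_surjective o
    obtain ⟨ω', rfl⟩ := QuotientGroup.mk_surjective o'
    rfl

theorem Inj.op_smul_bar (ω : MulAut T) (f : Inj T G) :
    MulOpposite.op (QuotientGroup.mk ω : OutGroup T) • f.bar = (f.comp ω).bar := rfl

/-- The triple `(λ(T), λ μ⁻¹, μ(T))`. -/
noncomputable def Inj.triple (f : Inj T G) (m : Inj T H) : IsoTriple G H :=
  ⟨f.1.range, m.1.range, (MonoidHom.ofInjective m.2).symm.trans (MonoidHom.ofInjective f.2)⟩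

theorem Inj.mem_graph_triple (f : Inj T G) (m : Inj T H) (p : G × H) :
    p ∈ (f.triple m).graph ↔ ∃ t : T, (f.1 t, m.1 t) = p := by
  constructor
  · rintro ⟨x, rfl⟩
    obtain ⟨t, rfl⟩ := (MonoidHom.ofInjective m.2).surjective x
    refine ⟨t, ?_⟩
    change _ = ((((MonoidHom.ofInjective f.2) ((MonoidHom.ofInjective m.2).symm
      ((MonoidHom.ofInjective m.2) t))) : G), _)
    rw [MulEquiv.symm_apply_apply]
    rfl
  · rintro ⟨t, rfl⟩
    refine ⟨(MonoidHom.ofInjective m.2) t, ?_⟩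
    change ((((MonoidHom.ofInjective f.2) ((MonoidHom.ofInjective m.2).symm
      ((MonoidHom.ofInjective m.2) t))) : G), _) = _
    rw [MulEquiv.symm_apply_apply]
    rfl

theorem Inj.triple_smul (f : Inj T G) (m : Inj T H) (g : G) (h : H) :
    (g • f).triple (h • m) = ((g, h) : G × H) • f.triple m := by
  refine IsoTriple.graph_injective (Subgroup.ext fun p => ?_)
  rw [IsoTriple.graph_smul, Inj.mem_graph_triple]
  constructor
  · rintro ⟨t, rfl⟩
    exact ⟨_, (Inj.mem_graph_triple f m _).2 ⟨t, rfl⟩, rfl⟩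
  · rintro ⟨q, hq, rfl⟩
    obtain ⟨t, rfl⟩ := (Inj.mem_graph_triple f m _).1 hq
    exact ⟨t, rfl⟩

theorem Inj.triple_comp (f : Inj T G) (m : Inj T H) (ω : MulAut T) :
    (f.comp ω).triple (m.comp ω) = f.triple m := by
  refine IsoTriple.graph_injective (Subgroup.ext fun p => ?_)
  rw [Inj.mem_graph_triple, Inj.mem_graph_triple]
  constructor
  · rintro ⟨t, rfl⟩
    exact ⟨ω t, rfl⟩
  · rintro ⟨t, rfl⟩
    refine ⟨ω⁻¹ t, ?_⟩
    change (f.1 (ω (ω⁻¹ t)), m.1 (ω (ω⁻¹ t))) = _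
    simp

end Injections

namespace BifreeSystem

section Homs

variable {ι : Type*} {Gr : ι → Type u} [∀ i, Group (Gr i)] (S : BifreeSystem Gr)
  (R : Type*) [CommRing R] (T : Type u) [Group T]

/-- The module `Hom^𝒮_{R Out(T)}(R Inj̄(T, H), R Inj̄(T, G))`: the `R`-linear maps `f` between
the permutation modules which commute with the right action of `Out(T)`, and such that `f [μ]`
lies in the span of those `[λ]` with `Δ(λ(T), λμ⁻¹, μ(T)) ∈ 𝒮_{G,H}`. -/
def homS (i j : ι) : Submodule R ((InjBar T (Gr j) →₀ R) →ₗ[R] (InjBar T (Gr i) →₀ R)) where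
  carrier := {f | (∀ (o : (OutGroup T)ᵐᵒᵖ) (x : InjBar T (Gr j) →₀ R),
      f (x.mapDomain (o • ·)) = (f x).mapDomain (o • ·)) ∧
    ∀ m : Inj T (Gr j), f (Finsupp.single m.bar 1) ∈
      Submodule.span R {v | ∃ l : Inj T (Gr i), (l.triple m).graph ∈ S.mem i j ∧
        v = Finsupp.single l.bar (1 : R)}}
  add_mem' := by
    rintro f g ⟨hf, hf'⟩ ⟨hg, hg'⟩
    refine ⟨fun o x => ?_, fun m => Submodule.add_mem _ (hf' m) (hg' m)⟩
    rw [LinearMap.add_apply, LinearMap.add_apply, hf, hg, Finsupp.mapDomain_add]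
  zero_mem' := ⟨fun o x => by simp, fun m => Submodule.zero_mem _⟩
  smul_mem' := by
    rintro c f ⟨hf, hf'⟩
    refine ⟨fun o x => ?_, fun m => Submodule.smul_mem _ c (hf' m)⟩
    rw [LinearMap.smul_apply, LinearMap.smul_apply, hf, Finsupp.mapDomain_smul]

variable {S R T}

theorem homS_comp {i j k : ι}
    {f : (InjBar T (Gr j) →₀ R) →ₗ[R] (InjBar T (Gr i) →₀ R)}
    {g : (InjBar T (Gr k) →₀ R) →ₗ[R] (InjBar T (Gr j) →₀ R)}
    (hf : f ∈ S.homS R T i j) (hg : g ∈ S.homS R T j k) : f ∘ₗ g ∈ S.homS R T i k := by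
  refine ⟨fun o x => ?_, fun m => ?_⟩
  · rw [LinearMap.comp_apply, LinearMap.comp_apply, hg.1, hf.1]
  · have h1 := Submodule.mem_map_of_mem (f := f) (hg.2 m)
    rw [Submodule.map_span] at h1
    refine (Submodule.span_le.2 ?_) h1
    rintro _ ⟨_, ⟨l, hl, rfl⟩, rfl⟩
    refine Submodule.span_mono ?_ (hf.2 l)
    rintro _ ⟨n, hn, rfl⟩
    refine ⟨n, S.sub (S.star hn hl) fun p hp => ?_, rfl⟩
    obtain ⟨t, rfl⟩ := (Inj.mem_graph_triple _ _ _).1 hp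
    exact ⟨l.1 t, (Inj.mem_graph_triple _ _ _).2 ⟨t, rfl⟩,
      (Inj.mem_graph_triple _ _ _).2 ⟨t, rfl⟩⟩

theorem homS_id (i : ι) : LinearMap.id ∈ S.homS R T i i := by
  refine ⟨fun o x => rfl, fun m => Submodule.subset_span ⟨m, S.sub (S.diag i) fun p hp => ?_, rfl⟩⟩
  obtain ⟨t, rfl⟩ := (Inj.mem_graph_triple _ _ _).1 hp
  exact ⟨m.1 t, rfl⟩

variable (S R T)

noncomputable instance homSAddCommGroup (i j : ι) : AddCommGroup (S.homS R T i j) :=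
  Module.addCommMonoidToAddCommGroup R

/-- The ring `End^𝒮_{R Out(T)}(R Inj̄(T, G))` under composition. -/
noncomputable instance homSRing (i : ι) : Ring (S.homS R T i i) :=
  { (inferInstance : AddCommGroup (S.homS R T i i)) with
    mul := fun f g => ⟨f.1 ∘ₗ g.1, homS_comp f.2 g.2⟩
    one := ⟨LinearMap.id, homS_id i⟩
    mul_assoc := fun _ _ _ => rfl
    one_mul := fun _ => rfl
    mul_one := fun _ => rfl
    left_distrib := fun f g h => Subtype.ext (LinearMap.comp_add g.1 h.1 f.1)
    right_distrib := fun f g h => Subtype.ext (LinearMap.add_comp h.1 g.1 f.1)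
    zero_mul := fun f => Subtype.ext (LinearMap.zero_comp f.1)
    mul_zero := fun f => Subtype.ext (LinearMap.comp_zero f.1) }

/-- The `R`-algebra `End^𝒮_{R Out(T)}(R Inj̄(T, G))`. -/
noncomputable instance homSAlgebra (i : ι) : Algebra R (S.homS R T i i) :=
  Algebra.ofModule
    (fun r f g => Subtype.ext (LinearMap.smul_comp r f.1 g.1))
    (fun r f g => Subtype.ext (LinearMap.comp_smul f.1 r g.1))

end Homs

end BifreeSystem

section Marks

variable {G H : Type u} [Group G] [Group H]

/-- The coefficient `|X^{Δ(U,α,V)}| / |C_G(U)|`, written for arbitrary elements of the double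
Burnside group in place of `[X]`. The division is exact on the classes of left-free bisets. -/
noncomputable def markCoeff (t : IsoTriple G H) (a : BurnsideGroup G H) : ℤ :=
  BurnsideGroup.mark t.graph a / Nat.card (Subgroup.centralizer (t.U : Set G))

theorem markCoeff_smul_triple (p : G × H) (t : IsoTriple G H) (a : BurnsideGroup G H) :
    markCoeff (p • t) a = markCoeff t a := by
  have h1 : Nat.card (Subgroup.centralizer ((p • t).U : Set G)) =
      Nat.card (Subgroup.centralizer (t.U : Set G)) := by
    refine (Nat.card_congr ((MulAut.conj p.1).toEquiv.subtypeEquiv fun g => ?_)).symm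
    change g ∈ Subgroup.centralizer (t.U : Set G) ↔ p.1 * g * p.1⁻¹ ∈
      Subgroup.centralizer ((t.U.map (MulAut.conj p.1).toMonoidHom : Subgroup G) : Set G)
    rw [Subgroup.mem_centralizer_iff, Subgroup.mem_centralizer_iff]
    constructor
    · rintro h _ ⟨x, hx, rfl⟩
      change p.1 * x * p.1⁻¹ * (p.1 * g * p.1⁻¹) = p.1 * g * p.1⁻¹ * (p.1 * x * p.1⁻¹)
      have h2 := h x hx
      calc _ = p.1 * (x * g) * p.1⁻¹ := by group
        _ = p.1 * (g * x) * p.1⁻¹ := by rw [h2]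
        _ = _ := by group
    · intro h x hx
      have h2 : p.1 * x * p.1⁻¹ * (p.1 * g * p.1⁻¹) = p.1 * g * p.1⁻¹ * (p.1 * x * p.1⁻¹) :=
        h _ ⟨x, hx, rfl⟩
      calc x * g = p.1⁻¹ * (p.1 * x * p.1⁻¹ * (p.1 * g * p.1⁻¹)) * p.1 := by group
        _ = p.1⁻¹ * (p.1 * g * p.1⁻¹ * (p.1 * x * p.1⁻¹)) * p.1 := by rw [h2]
        _ = g * x := by group
  rw [markCoeff, markCoeff, h1, IsoTriple.graph_smul, BurnsideGroup.mark_conj]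

end Marks

namespace BifreeSystem

variable {ι : Type*} {Gr : ι → Type u} [∀ i, Group (Gr i)] 
  {S : BifreeSystem Gr}

theorem homS_ext {R : Type*} [CommRing R] {T : Type u} [Group T] {i j : ι} {f g : S.homS R T i j}
    (h : ∀ (l : Inj T (Gr i)) (n : Inj T (Gr j)),
      f.1 (Finsupp.single n.bar 1) l.bar = g.1 (Finsupp.single n.bar 1) l.bar) : f = g := by
  refine Subtype.ext (Finsupp.lhom_ext' fun q => LinearMap.ext_ring ?_)
  obtain ⟨n, rfl⟩ := q.exists_rep
  ext p
  obtain ⟨l, rfl⟩ := p.exists_rep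
  exact h l n

theorem homS_add_apply {R : Type*} [CommRing R] {T : Type u} [Group T] {i j : ι}
    (f g : S.homS R T i j) (x : InjBar T (Gr j) →₀ R) (p : InjBar T (Gr i)) :
    (f + g).1 x p = f.1 x p + g.1 x p := rfl

theorem homS_zsmul_apply {R : Type*} [CommRing R] {T : Type u} [Group T] {i j : ι}
    (c : ℤ) (f : S.homS R T i j) (x : InjBar T (Gr j) →₀ R) (p : InjBar T (Gr i)) :
    (c • f).1 x p = c * f.1 x p := rfl

section Ghost

variable (S) (T : Type u) [Group T]

/-- The submodule of fixed points of the conjugation action of `G × H` on the free module with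
basis `I_{G,H}`. -/
noncomputable def conjInvariants (G H : Type u) [Group G] [Group H] : Submodule ℤ (IsoTriple G H →₀ ℤ) where
  carrier := {a | ∀ p : G × H, a.mapDomain (p • ·) = a}
  add_mem' := fun ha hb p => by rw [Finsupp.mapDomain_add, ha p, hb p]
  zero_mem' := fun p => Finsupp.mapDomain_zero
  smul_mem' := fun c a ha p => by rw [Finsupp.mapDomain_smul, ha p]

/-- The ghost group `B̃^𝒮(G, H)`: the `G × H`-fixed points of the free abelian group
`A^𝒮(G, H)` on the triples `(U, α, V)` with `Δ(U, α, V) ∈ 𝒮_{G,H}`. -/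
noncomputable def ghost (i j : ι) : Submodule ℤ (IsoTriple (Gr i) (Gr j) →₀ ℤ) :=
  Finsupp.supported ℤ ℤ {t | t.graph ∈ S.mem i j} ⊓ conjInvariants (Gr i) (Gr j)

/-- The component `B̃^𝒮_T(G, H)`, spanned by triples `(U, α, V)` with `U ≅ T ≅ V`. -/
noncomputable def ghostT (i j : ι) : Submodule ℤ (IsoTriple (Gr i) (Gr j) →₀ ℤ) :=
  Finsupp.supported ℤ ℤ {t | t.graph ∈ S.mem i j ∧ Nonempty (t.U ≃* T) ∧ Nonempty (t.V ≃* T)} ⊓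
    conjInvariants (Gr i) (Gr j)

theorem ghostT_smul {i j : ι} (a : S.ghostT T i j) (p : Gr i × Gr j)
    (t : IsoTriple (Gr i) (Gr j)) : a.1 (p • t) = a.1 t := by
  conv_lhs => rw [← a.2.2 p]
  exact Finsupp.mapDomain_apply (MulAction.injective p) _ _

end Ghost

variable [∀ i, Finite (Gr i)]

theorem card_dvd_mark {i j : ι} (t : IsoTriple (Gr i) (Gr j))
    {a : BurnsideGroup (Gr i) (Gr j)} (ha : a ∈ S.burnside i j) :
    (Nat.card (Subgroup.centralizer (t.U : Set (Gr i))) : ℤ) ∣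
      BurnsideGroup.mark t.graph a := by
  induction ha using Submodule.span_induction with
  | zero => simp
  | add x y _ _ hx hy =>
    rw [map_add]
    exact dvd_add hx hy
  | smul n x _ hx =>
    rw [map_zsmul]
    exact Dvd.dvd.mul_left hx n
  | mem a ha =>
  obtain ⟨L, hL, rfl⟩ := ha
  refine BurnsideGroup.card_dvd_mark_cls _ (fun g x hx => ?_) _ _ fun g hg p hp => ?_
  · exact fst_eq_one (stabilizer_coset hL x) hx
  · obtain ⟨x, rfl⟩ := IsoTriple.mem_graph.1 hp
    refine Prod.ext ?_ ?_
    · exact (Subgroup.mem_centralizer_iff.1 hg _ (t.α x).2).symm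
    · exact (one_mul _).trans (mul_one _).symm

theorem markCoeff_add {i j : ι} (t : IsoTriple (Gr i) (Gr j)) (a b : S.burnside i j) :
    markCoeff t (a + b : S.burnside i j).1 = markCoeff t a.1 + markCoeff t b.1 := by
  change BurnsideGroup.mark _ (a.1 + b.1) / _ = _
  rw [map_add, Int.add_ediv_of_dvd_left (card_dvd_mark t a.2)]
  rfl

theorem markCoeff_smul {i j : ι} (t : IsoTriple (Gr i) (Gr j)) (n : ℤ) (a : S.burnside i j) :
    markCoeff t (n • a : S.burnside i j).1 = n * markCoeff t a.1 := by
  change BurnsideGroup.mark _ (n • a.1) / _ = _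
  rw [map_zsmul, smul_eq_mul, Int.mul_ediv_assoc _ (card_dvd_mark t a.2)]
  rfl

theorem mem_of_markCoeff_ne_zero {i j : ι} {t : IsoTriple (Gr i) (Gr j)}
    {a : S.burnside i j} (h : markCoeff t a.1 ≠ 0) : t.graph ∈ S.mem i j := by
  by_contra hn
  refine h ?_
  suffices h1 : BurnsideGroup.mark t.graph a.1 = 0 by rw [markCoeff, h1, Int.zero_ediv]
  obtain ⟨a, ha⟩ := a
  clear h
  change BurnsideGroup.mark t.graph a = 0
  induction ha using Submodule.span_induction with
  | zero => simp
  | add x y _ _ hx hy => rw [map_add, hx, hy, add_zero]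
  | smul n x _ hx => rw [map_zsmul, hx, smul_zero]
  | mem a ha =>
  obtain ⟨L, hL, rfl⟩ := ha
  rw [BurnsideGroup.mark_cls, Nat.cast_eq_zero, Nat.card_eq_zero]
  refine Or.inl ⟨fun x => hn (S.sub (stabilizer_coset hL x.1) fun p hp => ?_)⟩
  exact x.2 ⟨p, hp⟩

section Matrix

variable (S) {R : Type*} [CommRing R] {T : Type u} [Group T] [Finite T]

/-- The linear map `R Inj̄(T, H) → R Inj̄(T, G)` sending `[μ]` to `∑_{[λ]} m(λ, μ) [λ]`, for a
matrix `m` with the invariance and support properties required of elements of `homS`. -/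
noncomputable def homSOf {i j : ι} (m : Inj T (Gr i) → Inj T (Gr j) → R)
    (hconj : ∀ (g : Gr i) (h : Gr j) l n, m (g • l) (h • n) = m l n)
    (hcomp : ∀ (ω : MulAut T) l n, m (l.comp ω) (n.comp ω) = m l n)
    (hS : ∀ l n, m l n ≠ 0 → (l.triple n).graph ∈ S.mem i j) : S.homS R T i j :=
  ⟨Finsupp.linearCombination R (fun q : InjBar T (Gr j) => Finsupp.equivFunOnFinite.symm
      (fun p : InjBar T (Gr i) => Quotient.liftOn₂ p q m (by
        rintro _ _ l n ⟨g, rfl⟩ ⟨h, rfl⟩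
        exact hconj g h l n))), by
    constructor
    · intro o x
      obtain ⟨o, rfl⟩ := MulOpposite.op_surjective o
      obtain ⟨ω, rfl⟩ := QuotientGroup.mk_surjective o
      induction x using Finsupp.induction_linear with
      | zero => simp
      | add x y hx hy => rw [Finsupp.mapDomain_add, map_add, map_add, hx, hy,
          Finsupp.mapDomain_add]
      | single q r =>
        rw [Finsupp.mapDomain_single, Finsupp.linearCombination_single,
          Finsupp.linearCombination_single, Finsupp.mapDomain_smul]
        congr 1
        ext p
        obtain ⟨n, rfl⟩ := q.exists_rep
        obtain ⟨p, rfl⟩ := MulAction.surjective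
          (MulOpposite.op (QuotientGroup.mk ω : OutGroup T)) p
        obtain ⟨l, rfl⟩ := p.exists_rep
        rw [Finsupp.mapDomain_apply (MulAction.injective _)]
        exact hcomp ω l n
    · intro n
      rw [Finsupp.linearCombination_single, one_smul]
      have : Fintype (InjBar T (Gr i)) := Fintype.ofFinite _
      rw [← Finsupp.univ_sum_single (Finsupp.equivFunOnFinite.symm _)]
      refine Submodule.sum_mem _ fun p _ => ?_
      obtain ⟨l, rfl⟩ := p.exists_rep
      change Finsupp.single l.bar (m l n) ∈ _
      by_cases h : m l n = 0
      · rw [h, Finsupp.single_zero]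
        exact Submodule.zero_mem _
      · rw [← mul_one (m l n), ← smul_eq_mul, ← Finsupp.smul_single]
        exact Submodule.smul_mem _ _ (Submodule.subset_span ⟨l, hS l n h, rfl⟩)⟩

theorem homSOf_apply {i j : ι} (m : Inj T (Gr i) → Inj T (Gr j) → R) (hconj) (hcomp) (hS)
    (l : Inj T (Gr i)) (n : Inj T (Gr j)) :
    (S.homSOf m hconj hcomp hS).1 (Finsupp.single n.bar 1) l.bar = m l n := by
  unfold homSOf
  simp only [Finsupp.linearCombination_single, one_smul]
  rfl

end Matrix

variable (S) (R : Type*) [CommRing R] (T : Type u) [Group T] [Finite T]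

/-- The map `σ_{G,H,T}`, with values in
`Hom^𝒮_{R Out(T)}(R Inj̄(T, H), R Inj̄(T, G))`: the image of `[X]` sends `[μ]` to
`∑_{[λ]} (|X^{Δ(λ(T), λμ⁻¹, μ(T))}| / |C_G(λ(T))|) [λ]`. -/
noncomputable def sigmaT (i j : ι) : S.burnside i j →ₗ[ℤ] S.homS R T i j where
  toFun a := S.homSOf (fun l n => ((markCoeff (l.triple n) a.1 : ℤ) : R))
    (fun g h l n => by rw [Inj.triple_smul, markCoeff_smul_triple])
    (fun ω l n => by rw [Inj.triple_comp])
    (fun l n h => mem_of_markCoeff_ne_zero (a := a) fun h0 => h (by rw [h0, Int.cast_zero]))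
  map_add' a b := homS_ext fun l n => by
    rw [homS_add_apply, homSOf_apply, homSOf_apply, homSOf_apply, markCoeff_add, Int.cast_add]
  map_smul' c a := homS_ext fun l n => by
    rw [RingHom.id_apply, homS_zsmul_apply, homSOf_apply, homSOf_apply, markCoeff_smul,
      Int.cast_mul]

open Classical in
/-- The mark homomorphism `ρ_{G,H} : B^𝒮(G, H) → B̃^𝒮(G, H)`,
`[X] ↦ ∑ (|X^{Δ(U,α,V)}| / |C_G(U)|) (U, α, V)`, summed over all triples with
`Δ(U, α, V) ∈ 𝒮_{G,H}`. -/
noncomputable def rho (i j : ι) : S.burnside i j →ₗ[ℤ] S.ghost i j where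
  toFun a := ⟨Finsupp.equivFunOnFinite.symm
      (fun t => if t.graph ∈ S.mem i j then markCoeff t a.1 else 0), by
    constructor
    · refine (Finsupp.mem_supported' _ _).2 fun t ht => ?_
      exact if_neg ht
    · intro p
      ext t
      obtain ⟨t, rfl⟩ := MulAction.surjective p t
      rw [Finsupp.mapDomain_apply (MulAction.injective p)]
      change (if t.graph ∈ S.mem i j then markCoeff t a.1 else 0) =
        (if (p • t).graph ∈ S.mem i j then markCoeff (p • t) a.1 else 0)
      simp only [markCoeff_smul_triple, IsoTriple.graph_smul, conj_iff]⟩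
  map_add' a b := Subtype.ext (Finsupp.ext fun t => by
    change (if t.graph ∈ S.mem i j then markCoeff t (a + b : S.burnside i j).1 else 0) =
      (if t.graph ∈ S.mem i j then markCoeff t a.1 else 0) +
      (if t.graph ∈ S.mem i j then markCoeff t b.1 else 0)
    split_ifs
    · exact markCoeff_add t a b
    · rfl)
  map_smul' c a := Subtype.ext (Finsupp.ext fun t => by
    change (if t.graph ∈ S.mem i j then markCoeff t (c • a : S.burnside i j).1 else 0) =
      c * (if t.graph ∈ S.mem i j then markCoeff t a.1 else 0)
    split_ifs
    · exact markCoeff_smul t c a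
    · exact (mul_zero c).symm)

open Classical in
/-- The projection of `B̃^𝒮(G, H)` onto its component `B̃^𝒮_T(G, H)`. -/
noncomputable def ghostProj (i j : ι) : S.ghost i j →ₗ[ℤ] S.ghostT T i j where
  toFun a := ⟨a.1.filter (fun t => Nonempty (t.U ≃* T) ∧ Nonempty (t.V ≃* T)), by
    constructor
    · refine (Finsupp.mem_supported' _ _).2 fun t ht => ?_
      rw [Finsupp.filter_apply]
      split_ifs with h
      · exact (Finsupp.mem_supported' _ _).1 a.2.1 t fun h' => ht ⟨h', h⟩
      · rfl
    · intro p
      ext t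
      obtain ⟨t, rfl⟩ := MulAction.surjective p t
      rw [Finsupp.mapDomain_apply (MulAction.injective p), Finsupp.filter_apply,
        Finsupp.filter_apply]
      have h1 : a.1 (p • t) = a.1 t := by
        conv_lhs => rw [← a.2.2 p]
        exact Finsupp.mapDomain_apply (MulAction.injective p) _ _
      have h2 : Nonempty ((p • t).U ≃* T) ↔ Nonempty (t.U ≃* T) :=
        ⟨fun ⟨e⟩ => ⟨((MulAut.conj p.1).subgroupMap t.U).trans e⟩,
          fun ⟨e⟩ => ⟨((MulAut.conj p.1).subgroupMap t.U).symm.trans e⟩⟩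
      have h3 : Nonempty ((p • t).V ≃* T) ↔ Nonempty (t.V ≃* T) :=
        ⟨fun ⟨e⟩ => ⟨((MulAut.conj p.2).subgroupMap t.V).trans e⟩,
          fun ⟨e⟩ => ⟨((MulAut.conj p.2).subgroupMap t.V).symm.trans e⟩⟩
      rw [h1, if_congr (and_congr h2 h3) rfl rfl]⟩
  map_add' a b := Subtype.ext (Finsupp.filter_add)
  map_smul' c a := Subtype.ext (Finsupp.filter_smul)

/-- The component `ρ_{G,H,T} : B^𝒮(G, H) → B̃^𝒮_T(G, H)` of the mark homomorphism. -/
noncomputable def rhoT (i j : ι) : S.burnside i j →ₗ[ℤ] S.ghostT T i j :=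
  S.ghostProj T i j ∘ₗ S.rho i j

/-- The connecting map `τ_{G,H,T}`: `τ(a)` sends `[μ]` to
`∑_{[λ]} a_{(λ(T), λμ⁻¹, μ(T))} [λ]`. -/
noncomputable def tauT (i j : ι) : S.ghostT T i j →+ S.homS ℤ T i j where
  toFun a := S.homSOf (fun l n => a.1 (l.triple n))
    (fun g h l n => by rw [Inj.triple_smul, ghostT_smul])
    (fun ω l n => by rw [Inj.triple_comp])
    (fun l n h => by
      by_contra hn
      exact h ((Finsupp.mem_supported' _ _).1 a.2.1 _ fun h' => hn h'.1))
  map_zero' := homS_ext fun l n => homSOf_apply S _ _ _ _ l n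
  map_add' a b := homS_ext fun l n => by
    rw [homS_add_apply, homSOf_apply, homSOf_apply, homSOf_apply]
    rfl

theorem sigmaT_apply (i j : ι) (a : S.burnside i j) (l : Inj T (Gr i)) (n : Inj T (Gr j)) :
    (S.sigmaT R T i j a).1 (Finsupp.single n.bar 1) l.bar =
      ((markCoeff (l.triple n) a.1 : ℤ) : R) := by
  exact homSOf_apply S (fun l n => ((markCoeff (l.triple n) a.1 : ℤ) : R))
    (fun g h l n => by rw [Inj.triple_smul, markCoeff_smul_triple])
    (fun ω l n => by rw [Inj.triple_comp])
    (fun l n h => mem_of_markCoeff_ne_zero (a := a) fun h0 => h (by rw [h0, Int.cast_zero])) l n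

section Collection

variable {𝒯 : Type*} (Tr : 𝒯 → Type u) [∀ t, Group (Tr t)] [∀ t, Finite (Tr t)]

/-- The collection `(σ_{G,H,T})_T` of all the maps `σ_{G,H,T}`. -/
noncomputable def sigma (i j : ι) : S.burnside i j →ₗ[ℤ] ∀ t, S.homS R (Tr t) i j :=
  LinearMap.pi fun t => S.sigmaT R (Tr t) i j

open scoped TensorProduct in
/-- The `R`-linear map on `R B^𝒮(G, H) = R ⊗ B^𝒮(G, H)` induced by the maps `σ_{G,H,T}`. -/
noncomputable def sigmaR (i j : ι) :
    R ⊗[ℤ] S.burnside i j →ₗ[R] ∀ t, S.homS R (Tr t) i j :=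
  (S.sigma R Tr i j).liftBaseChange R

end Collection

end BifreeSystem

section GhostProduct

variable (G H K : Type u) [Group G] [Group H] [Group K]

open Classical in
/-- The `ℚ`-bilinear product on the rational vector spaces with bases `I_{G,H}` and `I_{H,K}`:
`(U, α, V) · (V', β, W)` is `0` if `V ≠ V'`, and `(|C_H(V)| / |H|) (U, αβ, W)` if `V = V'`. -/
noncomputable def ghostMul :
    (IsoTriple G H →₀ ℚ) →ₗ[ℚ] (IsoTriple H K →₀ ℚ) →ₗ[ℚ] (IsoTriple G K →₀ ℚ) :=
  Finsupp.lift _ ℚ _ fun t => Finsupp.lift _ ℚ _ fun s =>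
    if h : t.V = s.U then
      Finsupp.single (t.comp s h)
        ((Nat.card (Subgroup.centralizer (t.V : Set H)) : ℚ) / Nat.card H)
    else 0

end GhostProduct

/-! ### Fixed points of twisted diagonals on tensor products -/

section FixedPoints

variable {T G H K : Type u} [Group T] [Group G] [Group H] [Group K]

/-! The multiplicativity of σ is a count of fixed points. For left-free bisets `X` and `Y`, the pair
`(l(t), n(t))` fixes `x ⊗ y` exactly when some `a ∈ H` satisfies `(l(t), a) x = x` and `(a, n(t)) y
= y`. Freeness of `Y` makes `a` unique, hence a homomorphism in `t`; freeness of `X` makes this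
homomorphism injective. Therefore `|H|` times the number of fixed points on `X ×_H Y` is a sum over
injections `m : T → H` of products of marks (`card_fixedPoints_tensor`). The orbit of `m` has `|H| /
|C_H(m(T))|` elements, so after division by the centralizer orders the sum over `m` becomes a sum
over orbits `[m]`, which is a matrix product (`markCoeff_bmul`).

The remaining claims about σ are linear algebra. Pairs `(l, n)` modulo `Aut(T)` are the same as
triples of type `T`, so the matrix coefficients of an `Out(T)`-homomorphism form a class function of
triples, zero outside `𝒮`. Hence the product over `T` of the Hom modules is the free module on the
conjugacy classes of triples in `𝒮` (`classCoeff_bijective`). The classes of transitive bisets, one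
for each of these conjugacy classes, span the source. In these coordinates σ is the table of marks
with rows divided by centralizer orders (`classCoeff_comp_sigmaR_comp`). It is triangular for the
order of the subgroup, and its diagonal entries `|N(L) : L| / |C_G(U)|` divide `|G × H|`, so its
determinant is a nonzero integer dividing a power of `|G × H|` (`det_markTable_dvd`).

The same dictionary for a single `T` makes τ bijective. The factor `|C_H(V)| / |H|` in the ghost
product is the weight that turns a sum over injections into a sum over orbits, so τ carries this
product to composition. -/

theorem Inj.mem_fixedPoints_triple {X : Type*} [MulAction (G × H) X] (l : Inj T G) (m : Inj T H)
    (x : X) : x ∈ MulAction.fixedPoints (l.triple m).graph X ↔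
      ∀ t, ((l.1 t, m.1 t) : G × H) • x = x := by
  constructor
  · intro h t
    exact h ⟨_, (Inj.mem_graph_triple l m _).2 ⟨t, rfl⟩⟩
  · rintro h ⟨p, hp⟩
    obtain ⟨t, rfl⟩ := (Inj.mem_graph_triple l m p).1 hp
    exact h t

/-- A biset is left free if no nontrivial element of the left group fixes a point. -/
def Biset.LeftFree (X : Biset G H) : Prop :=
  ∀ (g : G) (x : X.carrier), ((g, 1) : G × H) • x = x → g = 1

theorem Biset.LeftFree.eq_of_smul_eq {X : Biset G H} (hX : X.LeftFree) {g g' : G} {h : H}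
    {x x' : X.carrier} (e : ((g, h) : G × H) • x = x') (e' : ((g', h) : G × H) • x = x') :
    g = g' := by
  have h1 : ((g'⁻¹ * g, 1) : G × H) • x = x := by
    have h2 : ((g'⁻¹ * g, 1) : G × H) = ((g', h) : G × H)⁻¹ * (g, h) := by simp
    rw [h2, mul_smul, e, ← e', inv_smul_smul]
  exact (inv_mul_eq_one.1 (hX _ _ h1)).symm

/-- The fibres of `X × Y → X ×_H Y` are `H`-orbits, and they are regular because `H` already acts
freely on `Y`. Choosing one pair in each orbit identifies `H × F` with the preimage of `F`. -/
theorem card_fixedPoints_tensor_left [Finite H] (X : Biset G H) {Y : Biset H K}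
    (hY : Y.LeftFree) (F : Set (X.tensor Y).carrier) :
    Nat.card H * Nat.card F =
      Nat.card {w : X.carrier × Y.carrier // (Biset.tmk w.1 w.2 : (X.tensor Y).carrier) ∈ F} := by
  rw [← Nat.card_prod]
  choose x y hxy using fun z : (X.tensor Y).carrier => Biset.tmk_surj z
  have key : ∀ (h : H) z, (Biset.tmk (((1, h) : G × H) • x z) (((h, 1) : H × K) • y z) :
      (X.tensor Y).carrier) = z := fun h z => by
    conv_rhs => rw [hxy z]
    exact (Biset.tmk_eq.2 ⟨h, rfl, rfl⟩).symm
  refine Nat.card_congr (Equiv.ofBijective (fun q => ⟨(((1, q.1) : G × H) • x q.2.1,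
    ((q.1, 1) : H × K) • y q.2.1), by rw [key]; exact q.2.2⟩) ⟨?_, ?_⟩)
  · rintro ⟨h, z, hz⟩ ⟨h', z', hz'⟩ e
    have e1 : ((1, h) : G × H) • x z = ((1, h') : G × H) • x z' :=
      congrArg (fun w => w.1.1) e
    have e2 : ((h, 1) : H × K) • y z = ((h', 1) : H × K) • y z' :=
      congrArg (fun w => w.1.2) e
    obtain rfl : z = z' := by rw [← key h z, ← key h' z', e1, e2]
    rw [hY.eq_of_smul_eq e2 rfl]
  · rintro ⟨⟨a, b⟩, hab⟩
    obtain ⟨h, h1, h2⟩ := Biset.tmk_eq.1 (hxy (Biset.tmk a b)).symm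
    exact ⟨⟨h, ⟨_, hab⟩⟩, Subtype.ext (Prod.ext h1.symm h2.symm)⟩

/-- Counts the pairs `(x, y)` whose class is fixed, and sorts them by the injection `m` they
determine: `m(t)` is the unique `a` for which `(a, n(t))` fixes `y`, and then `(l(t), a)` fixes `x`.
-/
theorem card_fixedPoints_tensor [Finite H] {X : Biset G H} {Y : Biset H K}
    (hX : X.LeftFree) (hY : Y.LeftFree) (l : Inj T G) (n : Inj T K) [Fintype (Inj T H)] :
    Nat.card H * Nat.card (MulAction.fixedPoints (l.triple n).graph (X.tensor Y).carrier) =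
      ∑ m : Inj T H, Nat.card (MulAction.fixedPoints (l.triple m).graph X.carrier) *
        Nat.card (MulAction.fixedPoints (m.triple n).graph Y.carrier) := by
  rw [card_fixedPoints_tensor_left X hY]
  simp_rw [← Nat.card_prod]
  rw [← Nat.card_sigma]
  have hmem : ∀ q : (m : Inj T H) × (MulAction.fixedPoints (l.triple m).graph X.carrier ×
      MulAction.fixedPoints (m.triple n).graph Y.carrier),
      (Biset.tmk q.2.1.1 q.2.2.1 : (X.tensor Y).carrier) ∈
        MulAction.fixedPoints (l.triple n).graph (X.tensor Y).carrier := by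
    rintro ⟨m, ⟨x, hx⟩, ⟨y, hy⟩⟩
    rw [Inj.mem_fixedPoints_triple] at hx hy ⊢
    intro t
    refine Biset.tmk_eq.2 ⟨m.1 t, ?_, ?_⟩
    · change x = ((1, m.1 t) : G × H) • ((l.1 t, 1) : G × H) • x
      rw [smul_smul]
      simpa using (hx t).symm
    · change y = ((m.1 t, 1) : H × K) • ((1, n.1 t) : H × K) • y
      rw [smul_smul]
      simpa using (hy t).symm
  refine (Nat.card_congr (Equiv.ofBijective (fun q => ⟨(q.2.1.1, q.2.2.1), hmem q⟩)
    ⟨?_, ?_⟩)).symm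
  · rintro ⟨m, ⟨x, hx⟩, ⟨y, hy⟩⟩ ⟨m', ⟨x', hx'⟩, ⟨y', hy'⟩⟩ e
    obtain rfl : x = x' := congrArg (fun w => w.1.1) e
    obtain rfl : y = y' := congrArg (fun w => w.1.2) e
    -- The injection is recovered from `y` alone, by left freeness of `Y`.
    obtain rfl : m = m' := by
      rw [Inj.mem_fixedPoints_triple] at hy hy'
      exact Subtype.ext (MonoidHom.ext fun t => hY.eq_of_smul_eq (hy t) (hy' t))
    rfl
  · rintro ⟨⟨x, y⟩, h⟩
    rw [Inj.mem_fixedPoints_triple] at h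
    have h1 : ∀ t, ∃ a : H, ((l.1 t, a) : G × H) • x = x ∧ ((a, n.1 t) : H × K) • y = y := by
      intro t
      obtain ⟨a, h1, h2⟩ := Biset.tmk_eq.1 ((Biset.smul_tmk _ x y).symm.trans (h t))
      refine ⟨a, ?_, ?_⟩
      · rw [smul_smul] at h1
        simpa using h1.symm
      · rw [smul_smul] at h2
        simpa using h2.symm
    choose f hf1 hf2 using h1
    have hmul : ∀ s t, f (s * t) = f s * f t := fun s t => by
      -- Both `f (s * t)` and `f s * f t`, paired with `n.1 (s * t)`, fix `y`; left freeness of `Y`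
      -- makes them equal.
      refine hY.eq_of_smul_eq (hf2 (s * t)) ?_
      have h3 : ((f s * f t, n.1 (s * t)) : H × K) = (f s, n.1 s) * (f t, n.1 t) := by simp
      rw [h3, mul_smul, hf2, hf2]
    let m : T →* H := MonoidHom.mk' f hmul
    have hm : Function.Injective m := by
      refine (injective_iff_map_eq_one m).2 fun t ht => ?_
      -- If `f t = 1` then `(l.1 t, 1)` fixes `x`, so left freeness of `X` forces `l.1 t = 1`.
      have h4 := hf1 t
      rw [show f t = 1 from ht] at h4
      exact (injective_iff_map_eq_one l.1).1 l.2 t (hX _ _ h4)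
    exact ⟨⟨⟨m, hm⟩, ⟨x, (Inj.mem_fixedPoints_triple _ _ _).2 hf1⟩,
      ⟨y, (Inj.mem_fixedPoints_triple _ _ _).2 hf2⟩⟩, rfl⟩

theorem Inj.stabilizer_eq (m : Inj T H) :
    MulAction.stabilizer H m = Subgroup.centralizer (m.1.range : Set H) := by
  ext h
  rw [MulAction.mem_stabilizer_iff, Subgroup.mem_centralizer_iff]
  constructor
  · rintro e _ ⟨t, rfl⟩
    have h1 : h * m.1 t * h⁻¹ = m.1 t := congrArg (fun f : Inj T H => f.1 t) e
    exact (mul_inv_eq_iff_eq_mul.1 h1).symm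
  · intro e
    exact Subtype.ext (MonoidHom.ext fun t => mul_inv_eq_iff_eq_mul.2 (e _ ⟨t, rfl⟩).symm)

/-- Orbit-stabilizer: the stabilizer of `m` is the centralizer of its image, so the weights over one
orbit add up to `|H|`. The form without division serves both `ℤ` and `ℚ`. -/
theorem sum_card_centralizer_mul [Finite H] [Fintype (Inj T H)] [Fintype (InjBar T H)]
    {A : Type*} [CommRing A] (F : InjBar T H → A) :
    ∑ m : Inj T H, (Nat.card (Subgroup.centralizer (m.1.range : Set H)) : A) * F m.bar =
      Nat.card H * ∑ q, F q := by
  classical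
  rw [← Finset.sum_fiberwise (s := Finset.univ) (g := fun m : Inj T H => m.bar), Finset.mul_sum]
  refine Finset.sum_congr rfl fun q _ => ?_
  obtain ⟨n, rfl⟩ := q.exists_rep
  rw [Finset.sum_congr rfl (g := fun _ =>
    (Nat.card (Subgroup.centralizer (n.1.range : Set H)) : A) * F n.bar)]
  · rw [Finset.sum_const, nsmul_eq_mul, ← mul_assoc, ← Nat.cast_mul]
    congr 2
    rw [← Inj.stabilizer_eq, ← (MulAction.stabilizer H n).card_mul_index,
      MulAction.index_stabilizer, mul_comm]
    congr 1
    rw [← Set.ncard_coe_finset]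
    congr 1
    ext m
    simp [Inj.bar_eq, MulAction.mem_orbit_iff]
  -- Stabilizers along an orbit are conjugate, so the weight is constant on it.
  · intro m hm
    have h1 : m.bar = n.bar := (Finset.mem_filter.1 hm).2
    rw [h1]
    congr 2
    obtain ⟨h, rfl⟩ := Inj.bar_eq.1 h1
    rw [← Inj.stabilizer_eq, ← Inj.stabilizer_eq, MulAction.stabilizer_smul_eq_stabilizer_map_conj]
    exact Nat.card_congr (Subgroup.equivMapOfInjective _ _
      (MulAut.conj h).injective).symm.toEquiv

end FixedPoints

/-! ### Mark coefficients of a product -/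

namespace BifreeSystem

variable {ι : Type*} {Gr : ι → Type u} [∀ i, Group (Gr i)] [∀ i, Finite (Gr i)]
  {S : BifreeSystem Gr}

theorem leftFree_coset {i j : ι} {L : Subgroup (Gr i × Gr j)} (hL : L ∈ S.mem i j) :
    (Biset.coset L).LeftFree :=
  fun _ x hx => fst_eq_one (stabilizer_coset hL x) hx

theorem card_mul_markCoeff {i j : ι} (t : IsoTriple (Gr i) (Gr j)) (a : S.burnside i j) :
    (Nat.card (Subgroup.centralizer (t.U : Set (Gr i))) : ℤ) * markCoeff t a.1 =
      BurnsideGroup.mark t.graph a.1 :=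
  Int.mul_ediv_cancel' (card_dvd_mark t a.2)

/-- Both sides are bilinear, so the count for transitive bisets suffices; these are left free
because their stabilizers are twisted diagonals. -/
theorem card_mul_mark_bmul {T : Type u} [Group T] [Finite T] {i j k : ι}
    (a : S.burnside i j) (b : S.burnside j k) (l : Inj T (Gr i)) (n : Inj T (Gr k))
    [Fintype (Inj T (Gr j))] :
    (Nat.card (Gr j) : ℤ) * BurnsideGroup.mark (l.triple n).graph (S.bmul a b).1 =
      ∑ m : Inj T (Gr j), BurnsideGroup.mark (l.triple m).graph a.1 *
        BurnsideGroup.mark (m.triple n).graph b.1 := by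
  obtain ⟨a, ha⟩ := a
  obtain ⟨b, hb⟩ := b
  change (Nat.card (Gr j) : ℤ) * BurnsideGroup.mark (l.triple n).graph (BurnsideGroup.mul a b) =
      ∑ m : Inj T (Gr j), BurnsideGroup.mark (l.triple m).graph a *
        BurnsideGroup.mark (m.triple n).graph b
  induction ha using Submodule.span_induction with
  | zero => simp
  | add x y _ _ hx hy =>
    simp only [map_add, AddMonoidHom.add_apply, mul_add, add_mul, Finset.sum_add_distrib, hx, hy]
  | smul c x _ hx =>
    simp only [map_zsmul, AddMonoidHom.smul_apply, mul_smul_comm, smul_mul_assoc, hx,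
      Finset.smul_sum]
  | mem a ha =>
  obtain ⟨L, hL, rfl⟩ := ha
  induction hb using Submodule.span_induction with
  | zero => simp
  | add x y _ _ hx hy => simp only [map_add, mul_add, Finset.sum_add_distrib, hx, hy]
  | smul c x _ hx => simp only [map_zsmul, mul_smul_comm, hx, Finset.smul_sum]
  | mem b hb =>
  obtain ⟨M, hM, rfl⟩ := hb
  simp only [BurnsideGroup.mul_cls, BurnsideGroup.mark_cls]
  exact_mod_cast card_fixedPoints_tensor (leftFree_coset hL) (leftFree_coset hM) l n

/-- `F` is the descent of the product of coefficients to orbits of injections; passing it as an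
argument leaves open how the descent is constructed. -/
theorem markCoeff_bmul {T : Type u} [Group T] [Finite T] {i j k : ι}
    (a : S.burnside i j) (b : S.burnside j k) (l : Inj T (Gr i)) (n : Inj T (Gr k))
    [Fintype (InjBar T (Gr j))] (F : InjBar T (Gr j) → ℤ)
    (hF : ∀ m : Inj T (Gr j),
      F m.bar = markCoeff (l.triple m) a.1 * markCoeff (m.triple n) b.1) :
    markCoeff (l.triple n) (S.bmul a b).1 = ∑ q, F q := by
  have : Fintype (Inj T (Gr j)) := Fintype.ofFinite _
  have h1 := card_mul_mark_bmul a b l n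
  simp_rw [← card_mul_markCoeff] at h1
  have h2 := sum_card_centralizer_mul F
  have hG : (Nat.card (Gr j) : ℤ) ≠ 0 := Nat.cast_ne_zero.2 Nat.card_pos.ne'
  have hC : (Nat.card (Subgroup.centralizer (l.1.range : Set (Gr i))) : ℤ) ≠ 0 :=
    Nat.cast_ne_zero.2 Nat.card_pos.ne'
  -- Multiplying by `|H| · |C_G(l(T))|` clears both the orbit weights and the division in
  -- `markCoeff`.
  refine mul_left_cancel₀ hC (mul_left_cancel₀ hG ?_)
  refine h1.trans ?_
  rw [mul_left_comm, ← h2, Finset.mul_sum]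
  refine Finset.sum_congr rfl fun m _ => ?_
  rw [hF]
  change (Nat.card (Subgroup.centralizer (l.1.range : Set (Gr i))) : ℤ) * _ *
    ((Nat.card (Subgroup.centralizer (m.1.range : Set (Gr j))) : ℤ) * _) = _
  ring

end BifreeSystem

/-! ### Triples as pairs of injections modulo `Aut(T)` -/

section Triples

variable {T G H : Type u} [Group T] [Group G] [Group H]

theorem Inj.nonempty_equiv_U (l : Inj T G) (n : Inj T H) : Nonempty ((l.triple n).U ≃* T) :=
  ⟨(MonoidHom.ofInjective l.2).symm⟩

theorem Inj.nonempty_equiv_V (l : Inj T G) (n : Inj T H) : Nonempty ((l.triple n).V ≃* T) :=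
  ⟨(MonoidHom.ofInjective n.2).symm⟩

/-- Transport along `e`: take `n = e⁻¹` and `l = α e⁻¹`, followed by the inclusions. -/
theorem IsoTriple.exists_triple_eq (t : IsoTriple G H) (e : t.V ≃* T) :
    ∃ (l : Inj T G) (n : Inj T H), l.triple n = t := by
  refine ⟨⟨t.U.subtype.comp (e.symm.trans t.α).toMonoidHom,
    t.U.subtype_injective.comp (e.symm.trans t.α).injective⟩,
    ⟨t.V.subtype.comp e.symm.toMonoidHom, t.V.subtype_injective.comp e.symm.injective⟩,
    IsoTriple.graph_injective (Subgroup.ext fun p => ?_)⟩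
  refine (Inj.mem_graph_triple _ _ _).trans ⟨?_, ?_⟩
  · rintro ⟨s, rfl⟩
    exact ⟨e.symm s, rfl⟩
  · rintro ⟨h, rfl⟩
    refine ⟨e h, ?_⟩
    change ((t.α (e.symm (e h)) : G), (e.symm (e h) : H)) = _
    rw [e.symm_apply_apply]
    rfl

/-- Equal graphs mean that each `(l' t, n' t)` is `(l s, n s)` for some `s`, unique by injectivity.
The map `t ↦ s` is an injective endomorphism of `T`, hence an automorphism since `T` is finite. -/
theorem Inj.exists_comp_eq [Finite T] {l l' : Inj T G} {n n' : Inj T H}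
    (h : l.triple n = l'.triple n') : ∃ ω : MulAut T, l' = l.comp ω ∧ n' = n.comp ω := by
  have h1 : ∀ t, ∃ s, l.1 s = l'.1 t ∧ n.1 s = n'.1 t := fun t => by
    have h2 := (Inj.mem_graph_triple l' n' (l'.1 t, n'.1 t)).2 ⟨t, rfl⟩
    rw [← h] at h2
    obtain ⟨s, hs⟩ := (Inj.mem_graph_triple l n _).1 h2
    exact ⟨s, congrArg Prod.fst hs, congrArg Prod.snd hs⟩
  choose f hf1 hf2 using h1
  let φ : T →* T := MonoidHom.mk' f fun s t => n.2 (by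
    rw [map_mul, hf2, hf2, hf2, map_mul])
  have hφ : Function.Injective φ := fun s t hst => n'.2 (by
    rw [← hf2, ← hf2]
    exact congrArg n.1 hst)
  refine ⟨MulEquiv.ofBijective φ ⟨hφ, Finite.injective_iff_surjective.1 hφ⟩, ?_, ?_⟩
  · exact Subtype.ext (MonoidHom.ext fun t => (hf1 t).symm)
  · exact Subtype.ext (MonoidHom.ext fun t => (hf2 t).symm)

end Triples

theorem LinearMap.finsupp_apply_eq_sum {R α β : Type*} [CommSemiring R] [Fintype α]
    (f : (α →₀ R) →ₗ[R] (β →₀ R)) (x : α →₀ R) (p : β) :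
    f x p = ∑ q, f (Finsupp.single q 1) p * x q := by
  conv_lhs => rw [← Finsupp.univ_sum_single x]
  rw [map_sum, Finsupp.finsetSum_apply]
  refine Finset.sum_congr rfl fun q _ => ?_
  rw [← mul_one (x q), ← smul_eq_mul, ← Finsupp.smul_single, map_smul, Finsupp.smul_apply,
    smul_eq_mul, smul_eq_mul, mul_one, mul_comm]

/-! ### Matrix coefficients of `Out(T)`-homomorphisms -/

namespace BifreeSystem

variable {ι : Type*} {Gr : ι → Type u} [∀ i, Group (Gr i)] {S : BifreeSystem Gr}

section Coefficients

variable {R : Type*} [CommRing R] {T : Type u} [Group T] {i j : ι}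

theorem homS_apply_comp (f : S.homS R T i j) (l : Inj T (Gr i)) (n : Inj T (Gr j))
    (ω : MulAut T) : f.1 (Finsupp.single (n.comp ω).bar 1) (l.comp ω).bar =
      f.1 (Finsupp.single n.bar 1) l.bar := by
  have h := f.2.1 (MulOpposite.op (QuotientGroup.mk ω : OutGroup T)) (Finsupp.single n.bar 1)
  rw [Finsupp.mapDomain_single, Inj.op_smul_bar] at h
  rw [h, ← Inj.op_smul_bar, Finsupp.mapDomain_apply (MulAction.injective _)]

theorem homS_apply_eq_zero (f : S.homS R T i j) (l : Inj T (Gr i)) (n : Inj T (Gr j))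
    (h : (l.triple n).graph ∉ S.mem i j) : f.1 (Finsupp.single n.bar 1) l.bar = 0 := by
  refine Submodule.span_induction (p := fun v _ => v l.bar = 0) ?_ rfl ?_ ?_ (f.2.2 n)
  · rintro _ ⟨l', hl', rfl⟩
    refine Finsupp.single_eq_of_ne fun e => h ?_
    -- The support condition provides some `l'` in the orbit of `l`, not `l` itself; closure of `𝒮`
    -- under conjugation bridges the gap.
    obtain ⟨g, rfl⟩ := Inj.bar_eq.1 e
    rw [← one_smul (Gr j) n, Inj.triple_smul, IsoTriple.graph_smul]
    exact S.conj hl' _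
  · intro x y _ _ hx hy
    rw [Finsupp.add_apply, hx, hy, add_zero]
  · intro c x _ hx
    rw [Finsupp.smul_apply, hx, smul_zero]

/-- Conjugation disappears on passing to the orbits `[l]` and `[n]`, and the remaining ambiguity, an
automorphism of `T`, is absorbed by equivariance. Thus the coefficient is a function of the
conjugacy class of the triple. -/
theorem homS_apply_congr [Finite T] (f : S.homS R T i j) {l l' : Inj T (Gr i)}
    {n n' : Inj T (Gr j)} (p : Gr i × Gr j) (h : p • l'.triple n' = l.triple n) :
    f.1 (Finsupp.single n.bar 1) l.bar = f.1 (Finsupp.single n'.bar 1) l'.bar := by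
  rw [← Inj.triple_smul] at h
  obtain ⟨ω, rfl, rfl⟩ := Inj.exists_comp_eq h
  rw [homS_apply_comp, Inj.bar_eq.2 ⟨p.1, rfl⟩, Inj.bar_eq.2 ⟨p.2, rfl⟩]

theorem homS_comp_apply {k : ι} (f : S.homS R T i j) (g : S.homS R T j k)
    [Fintype (InjBar T (Gr j))] (l : Inj T (Gr i)) (n : Inj T (Gr k)) :
    (f.1 ∘ₗ g.1) (Finsupp.single n.bar 1) l.bar =
      ∑ q, f.1 (Finsupp.single q 1) l.bar * g.1 (Finsupp.single n.bar 1) q :=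
  LinearMap.finsupp_apply_eq_sum f.1 _ _

theorem homS_finsupp_ext {f g : (InjBar T (Gr j) →₀ R) →ₗ[R] (InjBar T (Gr i) →₀ R)}
    (h : ∀ (l : Inj T (Gr i)) (n : Inj T (Gr j)),
      f (Finsupp.single n.bar 1) l.bar = g (Finsupp.single n.bar 1) l.bar) : f = g := by
  refine Finsupp.lhom_ext' fun q => LinearMap.ext_ring ?_
  obtain ⟨n, rfl⟩ := q.exists_rep
  ext p
  obtain ⟨l, rfl⟩ := p.exists_rep
  exact h l n

end Coefficients

/-! ### Conjugacy classes of triples as coordinates -/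

section Classes

variable (S) in
/-- Conjugacy of triples with twisted diagonal in `𝒮_{G,H}`. -/
def tripleSetoid (i j : ι) : Setoid {t : IsoTriple (Gr i) (Gr j) // t.graph ∈ S.mem i j} :=
  (MulAction.orbitRel (Gr i × Gr j) (IsoTriple (Gr i) (Gr j))).comap Subtype.val

variable (S) in
/-- The `G × H`-conjugacy classes of triples with twisted diagonal in `𝒮_{G,H}`. -/
def TripleClass (i j : ι) : Type u := Quotient (S.tripleSetoid i j)

instance [∀ i, Finite (Gr i)] (i j : ι) : Finite (S.TripleClass i j) := Quotient.finite _

/-- The class of a triple. -/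
def TripleClass.mk {i j : ι} (t : IsoTriple (Gr i) (Gr j)) (h : t.graph ∈ S.mem i j) :
    S.TripleClass i j := Quotient.mk (S.tripleSetoid i j) ⟨t, h⟩

theorem TripleClass.mk_eq {i j : ι} {t t' : IsoTriple (Gr i) (Gr j)} {h : t.graph ∈ S.mem i j}
    {h' : t'.graph ∈ S.mem i j} :
    TripleClass.mk t h = TripleClass.mk t' h' ↔ ∃ p : Gr i × Gr j, p • t' = t :=
  Quotient.eq.trans MulAction.orbitRel_apply

/-- A representative of a class of triples. -/
noncomputable def TripleClass.rep {i j : ι} (c : S.TripleClass i j) : IsoTriple (Gr i) (Gr j) :=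
  (Quotient.out c).1

theorem TripleClass.rep_mem {i j : ι} (c : S.TripleClass i j) : c.rep.graph ∈ S.mem i j :=
  (Quotient.out c).2

theorem TripleClass.mk_rep {i j : ι} (c : S.TripleClass i j) :
    TripleClass.mk c.rep c.rep_mem = c := Quotient.out_eq c

theorem TripleClass.exists_smul_rep {i j : ι} (t : IsoTriple (Gr i) (Gr j))
    (h : t.graph ∈ S.mem i j) : ∃ p : Gr i × Gr j, p • t = (TripleClass.mk t h).rep :=
  TripleClass.mk_eq.1 (TripleClass.mk_rep _)

end Classes

section Evaluation

theorem ghostT_apply_eq_zero {T : Type u} [Group T] {i j : ι} (a : S.ghostT T i j)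
    {t : IsoTriple (Gr i) (Gr j)}
    (h : ¬ (t.graph ∈ S.mem i j ∧ Nonempty (t.U ≃* T) ∧ Nonempty (t.V ≃* T))) : a.1 t = 0 :=
  (Finsupp.mem_supported' _ _).1 a.2.1 t h

variable [∀ i, Finite (Gr i)] {R : Type*} [CommRing R]
  {𝒯 : Type*} {Tr : 𝒯 → Type u} [∀ t, Group (Tr t)]

theorem TripleClass.exists_triple_eq
    (hTr : ∀ (A : Type u) [Group A] [Finite A], ∃! t, Nonempty (A ≃* Tr t)) {i j : ι}
    (c : S.TripleClass i j) :
    ∃ (t : 𝒯) (l : Inj (Tr t) (Gr i)) (n : Inj (Tr t) (Gr j)), l.triple n = c.rep := by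
  obtain ⟨t, ⟨e⟩, -⟩ := hTr c.rep.V
  exact ⟨t, c.rep.exists_triple_eq e⟩

/-- A family of homomorphisms is determined by its coefficients at representatives of the
conjugacy classes of triples. -/
noncomputable def classCoeff
    (hTr : ∀ (A : Type u) [Group A] [Finite A], ∃! t, Nonempty (A ≃* Tr t)) (i j : ι) :
    (∀ t, S.homS R (Tr t) i j) →ₗ[R] (S.TripleClass i j → R) where
  toFun f c := (f (c.exists_triple_eq hTr).choose).1
    (Finsupp.single (c.exists_triple_eq hTr).choose_spec.choose_spec.choose.bar 1)
    (c.exists_triple_eq hTr).choose_spec.choose.bar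
  map_add' _ _ := rfl
  map_smul' _ _ := rfl

variable [∀ t, Finite (Tr t)]
  (hTr : ∀ (A : Type u) [Group A] [Finite A], ∃! t, Nonempty (A ≃* Tr t)) {i j : ι}

/-- The choices inside `classCoeff` are immaterial: the isomorphism type of `V` forces the index, by
uniqueness in `hTr`, and `homS_apply_congr` disposes of the two injections. -/
theorem classCoeff_mk (f : ∀ t, S.homS R (Tr t) i j) (t : 𝒯) (l : Inj (Tr t) (Gr i))
    (n : Inj (Tr t) (Gr j)) (h : (l.triple n).graph ∈ S.mem i j) :
    classCoeff hTr i j f (TripleClass.mk (l.triple n) h) =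
      (f t).1 (Finsupp.single n.bar 1) l.bar := by
  obtain ⟨p, hp⟩ := TripleClass.exists_smul_rep _ h
  -- The index `t'` is kept arbitrary so that it can be replaced by `t` together with the injections
  -- depending on it.
  have key : ∀ (t' : 𝒯) (l' : Inj (Tr t') (Gr i)) (n' : Inj (Tr t') (Gr j)),
      l'.triple n' = (TripleClass.mk (l.triple n) h).rep →
      (f t').1 (Finsupp.single n'.bar 1) l'.bar = (f t).1 (Finsupp.single n.bar 1) l.bar := by
    intro t' l' n' hc
    rw [← hp] at hc
    obtain rfl : t' = t := by
      obtain ⟨e⟩ := l'.nonempty_equiv_V n'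
      obtain ⟨e'⟩ := (p.1 • l).nonempty_equiv_V (p.2 • n)
      rw [Inj.triple_smul, ← hc] at e'
      exact (hTr (l'.triple n').V).unique ⟨e⟩ ⟨e'⟩
    exact homS_apply_congr (f t') p hc.symm
  exact key _ _ _ ((TripleClass.mk (l.triple n)
    h).exists_triple_eq hTr).choose_spec.choose_spec.choose_spec

/-- Coefficients outside `𝒮` vanish and those inside are class functions, which gives injectivity.
Conversely any function on classes, extended by zero, is an invariant matrix with the required
support. -/
theorem classCoeff_bijective :
    Function.Bijective (classCoeff (S := S) (R := R) hTr i j) := by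
  classical
  constructor
  · intro f g hfg
    refine funext fun t => homS_ext fun l n => ?_
    by_cases h : (l.triple n).graph ∈ S.mem i j
    · rw [← classCoeff_mk hTr f t l n h, ← classCoeff_mk hTr g t l n h, hfg]
    · rw [homS_apply_eq_zero _ _ _ h, homS_apply_eq_zero _ _ _ h]
  · intro y
    let z : IsoTriple (Gr i) (Gr j) → R := fun t =>
      if h : t.graph ∈ S.mem i j then y (TripleClass.mk t h) else 0
    have hz : ∀ (p : Gr i × Gr j) t, z (p • t) = z t := by
      intro p t
      by_cases h : t.graph ∈ S.mem i j
      · have h' : (p • t).graph ∈ S.mem i j := by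
          rw [IsoTriple.graph_smul]
          exact S.conj h p
        have h1 : TripleClass.mk (p • t) h' = TripleClass.mk t h := TripleClass.mk_eq.2 ⟨p, rfl⟩
        simp only [z, dif_pos h, dif_pos h', h1]
      · have h' : (p • t).graph ∉ S.mem i j := by
          rwa [IsoTriple.graph_smul, conj_iff]
        simp only [z, dif_neg h, dif_neg h']
    refine ⟨fun t => S.homSOf (fun l n => z (l.triple n)) (fun g h l n => ?_) (fun ω l n => ?_)
      (fun l n h => ?_), funext fun c => ?_⟩
    · rw [Inj.triple_smul, hz]
    · rw [Inj.triple_comp]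
    · by_contra hn
      exact h (dif_neg hn)
    · obtain ⟨t, l, n, h⟩ := c.exists_triple_eq hTr
      have hm : (l.triple n).graph ∈ S.mem i j := h ▸ c.rep_mem
      obtain rfl : TripleClass.mk (l.triple n) hm = c := by
        conv_rhs => rw [← c.mk_rep]
        congr 1
      rw [classCoeff_mk, homSOf_apply]
      exact dif_pos hm

theorem tauT_apply (T : Type u) [Group T] [Finite T] (a : S.ghostT T i j) (l : Inj T (Gr i))
    (n : Inj T (Gr j)) :
    (S.tauT T i j a).1 (Finsupp.single n.bar 1) l.bar = a.1 (l.triple n) :=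
  homSOf_apply S (fun l n => a.1 (l.triple n))
    (fun g h l n => by rw [Inj.triple_smul, ghostT_smul])
    (fun ω l n => by rw [Inj.triple_comp])
    (fun l n h => by
      by_contra hn
      exact h (ghostT_apply_eq_zero a fun h' => hn h'.1)) l n

theorem nonempty_equiv_smul {T G H : Type u} [Group T] [Group G] [Group H] (p : G × H)
    (t : IsoTriple G H) : Nonempty ((p • t).V ≃* T) ↔ Nonempty (t.V ≃* T) :=
  ⟨fun ⟨e⟩ => ⟨((MulAut.conj p.2).subgroupMap t.V).trans e⟩,
    fun ⟨e⟩ => ⟨((MulAut.conj p.2).subgroupMap t.V).symm.trans e⟩⟩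

/-- Triples of type `T` are exactly the `l.triple n`, so an element of the ghost component and a
matrix of coefficients carry the same data. The inverse reads the coefficient at any pair
representing the triple. -/
theorem tauT_bijective (T : Type u) [Group T] [Finite T] :
    Function.Bijective (S.tauT T i j) := by
  classical
  constructor
  · intro a b hab
    refine Subtype.ext (Finsupp.ext fun t => ?_)
    by_cases h : t.graph ∈ S.mem i j ∧ Nonempty (t.U ≃* T) ∧ Nonempty (t.V ≃* T)
    · obtain ⟨-, -, ⟨e⟩⟩ := h
      obtain ⟨l, n, rfl⟩ := t.exists_triple_eq e
      rw [← tauT_apply, ← tauT_apply, hab]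
    · rw [ghostT_apply_eq_zero a h, ghostT_apply_eq_zero b h]
  · intro f
    -- Testing `V` is enough, since `α` makes `U` and `V` isomorphic.
    let z : IsoTriple (Gr i) (Gr j) → ℤ := fun t => if h : Nonempty (t.V ≃* T) then
      f.1 (Finsupp.single (t.exists_triple_eq h.some).choose_spec.choose.bar 1)
        (t.exists_triple_eq h.some).choose.bar else 0
    -- This gives at once independence of the chosen pair and invariance under conjugation.
    have hz : ∀ (p : Gr i × Gr j) (t : IsoTriple (Gr i) (Gr j)) (l : Inj T (Gr i))
        (n : Inj T (Gr j)), p • t = l.triple n →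
        z t = f.1 (Finsupp.single n.bar 1) l.bar := by
      intro p t l n hp
      have h : Nonempty (t.V ≃* T) := by
        rw [← nonempty_equiv_smul p, hp]
        exact l.nonempty_equiv_V n
      have hc := (t.exists_triple_eq h.some).choose_spec.choose_spec
      refine (dif_pos h).trans (homS_apply_congr f p ?_).symm
      rw [hc, hp]
    have hz0 : ∀ t : IsoTriple (Gr i) (Gr j), z t ≠ 0 →
        ∃ (l : Inj T (Gr i)) (n : Inj T (Gr j)), l.triple n = t ∧ t.graph ∈ S.mem i j := by
      intro t ht
      by_cases h : Nonempty (t.V ≃* T)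
      · obtain ⟨l, n, rfl⟩ := t.exists_triple_eq h.some
        refine ⟨l, n, rfl, ?_⟩
        by_contra hn
        exact ht ((hz 1 _ l n (one_smul _ _)).trans (homS_apply_eq_zero f l n hn))
      · exact absurd (dif_neg h) ht
    refine ⟨⟨Finsupp.equivFunOnFinite.symm z, ?_, ?_⟩, homS_ext fun l n => ?_⟩
    · refine (Finsupp.mem_supported' _ _).2 fun t ht => ?_
      by_contra hn
      obtain ⟨l, n, rfl, hm⟩ := hz0 t hn
      exact ht ⟨hm, l.nonempty_equiv_U n, l.nonempty_equiv_V n⟩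
    · intro p
      ext t
      obtain ⟨t, rfl⟩ := MulAction.surjective p t
      rw [Finsupp.mapDomain_apply (MulAction.injective p)]
      change z t = z (p • t)
      by_cases h : Nonempty ((p • t).V ≃* T)
      · obtain ⟨l, n, hln⟩ := (p • t).exists_triple_eq h.some
        rw [hz p t l n hln.symm, hz 1 (p • t) l n (by rw [one_smul, hln])]
      · have h' : ¬ Nonempty (t.V ≃* T) := by rwa [← nonempty_equiv_smul p]
        have h0 : ∀ t : IsoTriple (Gr i) (Gr j), ¬ Nonempty (t.V ≃* T) → z t = 0 :=
          fun t ht => dif_neg ht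
        rw [h0 _ h, h0 _ h']
    · rw [tauT_apply]
      exact hz 1 _ l n (one_smul _ _)

theorem tauT_rhoT (T : Type u) [Group T] [Finite T] (a : S.burnside i j) :
    S.tauT T i j (S.rhoT T i j a) = S.sigmaT ℤ T i j a := by
  classical
  refine homS_ext fun l n => ?_
  rw [tauT_apply, sigmaT_apply, Int.cast_id]
  change ((S.rho i j a).1.filter _) (l.triple n) = _
  refine (Finsupp.filter_apply_pos _ _ ⟨l.nonempty_equiv_U n, l.nonempty_equiv_V n⟩).trans ?_
  change (if (l.triple n).graph ∈ S.mem i j then markCoeff (l.triple n) a.1 else 0) = _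
  split_ifs with h
  · rfl
  -- Marks vanish at triples outside `𝒮`, so the truncation in `rho` loses nothing.
  · by_contra h0
    exact h (mem_of_markCoeff_ne_zero (Ne.symm h0))

theorem sigmaT_bmul {R : Type*} [CommRing R] (T : Type u) [Group T] [Finite T] {k : ι}
    (a : S.burnside i j) (b : S.burnside j k) :
    (S.sigmaT R T i k (S.bmul a b)).1 = (S.sigmaT R T i j a).1 ∘ₗ (S.sigmaT R T j k b).1 := by
  have : Fintype (InjBar T (Gr j)) := Fintype.ofFinite _
  refine homS_finsupp_ext fun l n => ?_
  -- The entries of the integral σ are already functions of orbits, so they supply the descended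
  -- product required by `markCoeff_bmul`.
  rw [homS_comp_apply, sigmaT_apply, markCoeff_bmul a b l n
    (fun q => (S.sigmaT ℤ T i j a).1 (Finsupp.single q 1) l.bar *
      (S.sigmaT ℤ T j k b).1 (Finsupp.single n.bar 1) q)
    (fun m => by rw [sigmaT_apply, sigmaT_apply, Int.cast_id, Int.cast_id]), Int.cast_sum]
  refine Finset.sum_congr rfl fun q _ => ?_
  obtain ⟨m, rfl⟩ := q.exists_rep
  rw [sigmaT_apply, sigmaT_apply, sigmaT_apply, sigmaT_apply, Int.cast_mul, Int.cast_id,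
    Int.cast_id]

end Evaluation

end BifreeSystem

/-! ### Marks of transitive bisets -/

section CosetMarks

variable {G H : Type u} [Group G] [Group H]

theorem Biset.stabilizer_coset_mk (M : Subgroup (G × H)) (p : G × H) :
    MulAction.stabilizer (G × H) (QuotientGroup.mk p : (G × H) ⧸ M) =
      M.map (MulAut.conj p).toMonoidHom := by
  have h : (QuotientGroup.mk p : (G × H) ⧸ M) = p • (QuotientGroup.mk 1 : (G × H) ⧸ M) := by
    rw [MulAction.Quotient.smul_mk, smul_eq_mul, mul_one]
  rw [h, MulAction.stabilizer_smul_eq_stabilizer_map_conj]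
  congr 1
  exact MulAction.stabilizer_quotient M

variable [Finite G] [Finite H]

/-- The conjugate of `M` by `p` is the stabilizer of the coset `pM`, so orbit-stabilizer at that
point gives the isomorphism. -/
theorem Biset.coset_map_conj_iso (M : Subgroup (G × H)) (p : G × H) :
    Iso (coset (M.map (MulAut.conj p).toMonoidHom)) (coset M) := by
  rw [← stabilizer_coset_mk]
  refine iso_of_bijective
    (MulAction.ofQuotientStabilizer (G × H) (QuotientGroup.mk p : (G × H) ⧸ M))
    ⟨MulAction.injective_ofQuotientStabilizer _ _, fun y => ?_⟩
    fun q x => MulAction.ofQuotientStabilizer_smul (G × H) _ q x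
  obtain ⟨q, hq⟩ := MulAction.exists_smul_eq (G × H) (QuotientGroup.mk p : (G × H) ⧸ M) y
  exact ⟨QuotientGroup.mk q, hq⟩

/-- A fixed coset `pM` puts `L` inside its stabilizer, the conjugate of `M` by `p`. -/
theorem BurnsideGroup.exists_le_conj_of_mark_ne_zero {L M : Subgroup (G × H)}
    (h : mark L (cls (Biset.coset M)) ≠ 0) :
    ∃ p : G × H, L ≤ M.map (MulAut.conj p).toMonoidHom := by
  rw [mark_cls, Nat.cast_ne_zero] at h
  obtain ⟨⟨x, hx⟩⟩ := (Nat.card_ne_zero.1 h).1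
  obtain ⟨p, rfl⟩ := QuotientGroup.mk_surjective (x : (G × H) ⧸ M)
  refine ⟨p, fun q hq => ?_⟩
  rw [← Biset.stabilizer_coset_mk]
  exact hx ⟨q, hq⟩

/-- The fixed points of `L` on the cosets of `L` correspond to `N(L) / L`. -/
theorem BurnsideGroup.mark_coset_self_dvd (L : Subgroup (G × H)) :
    mark L (cls (Biset.coset L)) ∣ Nat.card (G × H) := by
  rw [mark_cls, Int.natCast_dvd_natCast]
  refine (Nat.card_congr (Sylow.fixedPointsMulLeftCosetsEquivQuotient L)).dvd.trans ?_
  exact (Subgroup.card_quotient_dvd_card _).trans (Subgroup.card_subgroup_dvd_card _)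

end CosetMarks

theorem Subgroup.card_map_conj {G : Type*} [Group G] (M : Subgroup G) (p : G) :
    Nat.card (M.map (MulAut.conj p).toMonoidHom) = Nat.card M :=
  Nat.card_congr (M.equivMapOfInjective _ (MulAut.conj p).injective).symm.toEquiv

/-! ### The table of marks and its determinant -/

namespace BifreeSystem

variable {ι : Type*} {Gr : ι → Type u} [∀ i, Group (Gr i)] [∀ i, Finite (Gr i)]
  (S : BifreeSystem Gr) (i j : ι)

variable {S i j} in
/-- The element `[(G × H) / L]` of `B^𝒮(G, H)`, for `L` the twisted diagonal representing a
conjugacy class. -/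
noncomputable def TripleClass.coset (c : S.TripleClass i j) : S.burnside i j :=
  ⟨BurnsideGroup.cls (Biset.coset c.rep.graph), Submodule.subset_span ⟨_, c.rep_mem, rfl⟩⟩

/-- The table of marks of `B^𝒮(G, H)`, with rows divided by centralizer orders. -/
noncomputable def markTable : Matrix (S.TripleClass i j) (S.TripleClass i j) ℤ :=
  fun c c' => markCoeff c.rep c'.coset.1

variable {S i j}

/-- Conjugate subgroups give isomorphic transitive bisets, so one per class suffices. Spanning is
all that the later arguments use; linear independence of the cosets is not needed as input. -/
theorem span_range_coset :
    Submodule.span ℤ (Set.range (TripleClass.coset : S.TripleClass i j → S.burnside i j)) = ⊤ := by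
  refine eq_top_iff.2 fun a _ => ?_
  have h : ∀ b ∈ S.burnside i j, b ∈ (Submodule.span ℤ (Set.range
      (TripleClass.coset : S.TripleClass i j → S.burnside i j))).map (S.burnside i j).subtype := by
    refine fun b hb => Submodule.span_le.2 ?_ hb
    rintro _ ⟨L, hL, rfl⟩
    obtain ⟨t, rfl⟩ := S.twisted hL
    refine ⟨(TripleClass.mk t hL).coset, Submodule.subset_span ⟨_, rfl⟩, ?_⟩
    obtain ⟨p, hp⟩ := TripleClass.exists_smul_rep t hL
    change BurnsideGroup.cls (Biset.coset (TripleClass.mk t hL).rep.graph) = _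
    rw [← hp, IsoTriple.graph_smul]
    exact BurnsideGroup.cls_eq (Biset.coset_map_conj_iso _ _)
  obtain ⟨b, hb, hab⟩ := h a.1 a.2
  rwa [← Subtype.ext (a1 := b) hab]

/-- A nonzero entry embeds the first twisted diagonal in a conjugate of the second; equal orders
turn the inclusion into equality. This is the triangularity of the table. -/
theorem markTable_ne_zero {c c' : S.TripleClass i j} (h : S.markTable i j c c' ≠ 0) :
    Nat.card c.rep.graph ≤ Nat.card c'.rep.graph ∧
      (Nat.card c.rep.graph = Nat.card c'.rep.graph → c = c') := by
  have h1 : BurnsideGroup.mark c.rep.graph c'.coset.1 ≠ 0 := fun h0 => h (by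
    rw [markTable, markCoeff, h0, Int.zero_ediv])
  obtain ⟨p, hp⟩ := BurnsideGroup.exists_le_conj_of_mark_ne_zero h1
  have h2 := Subgroup.card_map_conj c'.rep.graph p
  refine ⟨?_, fun e => ?_⟩
  · rw [← h2]
    exact Subgroup.card_le_of_le hp
  · have h3 := Subgroup.eq_of_le_of_card_ge hp (h2.trans e.symm).le
    rw [← IsoTriple.graph_smul] at h3
    rw [← c.mk_rep, ← c'.mk_rep, TripleClass.mk_eq]
    exact ⟨p, (IsoTriple.graph_injective h3).symm⟩

/-- A diagonal entry times a centralizer order is `|N(L) : L|`. -/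
theorem markTable_self_dvd (c : S.TripleClass i j) :
    S.markTable i j c c ∣ Nat.card (Gr i × Gr j) :=
  (Dvd.intro_left _ (card_mul_markCoeff c.rep c.coset)).trans
    (BurnsideGroup.mark_coset_self_dvd c.rep.graph)

/-- Ordering classes by the order of their twisted diagonals makes the table block triangular.
Distinct classes of the same order have zero entry, so each diagonal block is a diagonal matrix with
entries dividing `|G × H|`. -/
theorem det_markTable_dvd [Fintype (S.TripleClass i j)] [DecidableEq (S.TripleClass i j)] :
    ∃ N : ℕ, (S.markTable i j).det ∣ (Nat.card (Gr i × Gr j) : ℤ) ^ N := by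
  have ht : (S.markTable i j).BlockTriangular fun c => Nat.card c.rep.graph := by
    intro c c' h
    by_contra h0
    exact absurd (markTable_ne_zero h0).1 (not_le.2 h)
  rw [ht.det]
  have hblock : ∀ k, ∃ N : ℕ, ((S.markTable i j).toSquareBlock
      (fun c => Nat.card c.rep.graph) k).det ∣ (Nat.card (Gr i × Gr j) : ℤ) ^ N := by
    intro k
    have hd : (S.markTable i j).toSquareBlock (fun c => Nat.card c.rep.graph) k =
        Matrix.diagonal fun c => S.markTable i j c.1 c.1 := by
      ext ⟨c, hc⟩ ⟨c', hc'⟩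
      by_cases e : c = c'
      · subst e
        rw [Matrix.diagonal_apply_eq]
        rfl
      · rw [Matrix.diagonal_apply_ne _ (fun h => e (congrArg Subtype.val h))]
        by_contra h0
        exact e ((markTable_ne_zero h0).2 (hc.trans hc'.symm))
    rw [hd, Matrix.det_diagonal]
    have h := Finset.prod_dvd_prod_of_dvd (s := Finset.univ) _ _ fun
      (c : {c : S.TripleClass i j // Nat.card c.rep.graph = k}) _ => markTable_self_dvd c.1
    rw [Finset.prod_const] at h
    exact ⟨_, h⟩
  choose N hN using hblock
  have h := Finset.prod_dvd_prod_of_dvd (s := Finset.univ.image fun c : S.TripleClass i j =>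
    Nat.card c.rep.graph) _ _ fun k _ => hN k
  rw [Finset.prod_pow_eq_pow_sum] at h
  exact ⟨_, h⟩

theorem det_markTable_ne_zero [Fintype (S.TripleClass i j)] [DecidableEq (S.TripleClass i j)] :
    (S.markTable i j).det ≠ 0 := by
  obtain ⟨N, hN⟩ := det_markTable_dvd (S := S) (i := i) (j := j)
  exact ne_zero_of_dvd_ne_zero (pow_ne_zero _ (Nat.cast_ne_zero.2 Nat.card_pos.ne')) hN

section Sigma

variable {R : Type*} [CommRing R] {𝒯 : Type*} {Tr : 𝒯 → Type u} [∀ t, Group (Tr t)]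
  [∀ t, Finite (Tr t)] (hTr : ∀ (A : Type u) [Group A] [Finite A], ∃! t, Nonempty (A ≃* Tr t))

theorem classCoeff_sigma (a : S.burnside i j) (c : S.TripleClass i j) :
    classCoeff hTr i j (S.sigma R Tr i j a) c = (markCoeff c.rep a.1 : ℤ) := by
  obtain ⟨t, l, n, h⟩ := c.exists_triple_eq hTr
  have hm : (l.triple n).graph ∈ S.mem i j := h ▸ c.rep_mem
  obtain rfl : TripleClass.mk (l.triple n) hm = c := by
    conv_rhs => rw [← c.mk_rep]
    congr 1
  rw [classCoeff_mk, ← h]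
  exact sigmaT_apply S R (Tr t) i j a l n

open scoped TensorProduct

variable [Fintype (S.TripleClass i j)]

/-- The linear combinations of the classes `[(G × H) / L]`. -/
noncomputable def cosetCombination (R : Type*) [CommRing R] :
    (S.TripleClass i j → R) →ₗ[R] R ⊗[ℤ] S.burnside i j :=
  Fintype.linearCombination R fun c => (1 : R) ⊗ₜ[ℤ] c.coset

theorem cosetCombination_surjective :
    Function.Surjective (cosetCombination (S := S) (i := i) (j := j) R) := by
  rw [← LinearMap.range_eq_top, cosetCombination, Fintype.range_linearCombination, eq_top_iff]
  rintro x -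
  induction x using TensorProduct.induction_on with
  | zero => exact Submodule.zero_mem _
  | add x y hx hy => exact Submodule.add_mem _ hx hy
  | tmul r a =>
    have ha : a ∈ Submodule.span ℤ
        (Set.range (TripleClass.coset : S.TripleClass i j → S.burnside i j)) := by
      rw [span_range_coset]
      trivial
    rw [← mul_one r, ← smul_eq_mul, ← TensorProduct.smul_tmul']
    refine Submodule.smul_mem _ _ ?_
    induction ha using Submodule.span_induction with
    | zero =>
      rw [TensorProduct.tmul_zero]
      exact Submodule.zero_mem _
    | add x y _ _ hx hy =>
      rw [TensorProduct.tmul_add]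
      exact Submodule.add_mem _ hx hy
    | smul n x _ hx =>
      rw [TensorProduct.tmul_smul, ← Int.cast_smul_eq_zsmul R]
      exact Submodule.smul_mem _ _ hx
    | mem x hx =>
      obtain ⟨c, rfl⟩ := hx
      exact Submodule.subset_span ⟨c, rfl⟩

/-- Reduces σ to a matrix: the coordinates on the target are bijective, and those on the source are
surjective. -/
theorem classCoeff_comp_sigmaR_comp [DecidableEq (S.TripleClass i j)] :
    classCoeff hTr i j ∘ₗ S.sigmaR R Tr i j ∘ₗ cosetCombination R =
      ((S.markTable i j).map (Int.cast : ℤ → R)).mulVecLin := by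
  refine LinearMap.ext fun y => funext fun c => ?_
  simp only [LinearMap.comp_apply, cosetCombination, Fintype.linearCombination_apply, map_sum,
    map_smul, Finset.sum_apply, Pi.smul_apply, Matrix.mulVecLin_apply, Matrix.mulVec, dotProduct,
    Matrix.map_apply]
  refine Finset.sum_congr rfl fun c' _ => ?_
  have h1 : S.sigmaR R Tr i j (1 ⊗ₜ[ℤ] c'.coset) = S.sigma R Tr i j c'.coset := by
    simp [sigmaR]
  rw [h1, classCoeff_sigma, smul_eq_mul, mul_comm]
  rfl

end Sigma

end BifreeSystem

/-! ### Injectivity, finite cokernel and bijectivity of σ -/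

namespace BifreeSystem

variable {ι : Type*} {Gr : ι → Type u} [∀ i, Group (Gr i)] {S : BifreeSystem Gr} {i j : ι}
  {R : Type*} [CommRing R]

theorem nonempty_inj_of_nontrivial_homS {T : Type u} [Group T]
    (h : Nontrivial (S.homS R T i j)) : Nonempty (Inj T (Gr j)) := by
  by_contra hn
  rw [not_nonempty_iff] at hn
  obtain ⟨f, g, hfg⟩ := h
  exact hfg (homS_ext fun _ n => isEmptyElim n)

variable [∀ i, Finite (Gr i)]

/-- A nonzero module needs an injection of `T` into `H`, so `T` is the type of one of the finitely
many subgroups of `H`. -/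
theorem finite_setOf_nontrivial_homS {𝒯 : Type*} {Tr : 𝒯 → Type u} [∀ t, Group (Tr t)]
    (hTr : ∀ (A : Type u) [Group A] [Finite A], ∃! t, Nonempty (A ≃* Tr t)) :
    {t : 𝒯 | Nontrivial (S.homS ℤ (Tr t) i j) ∨ Nontrivial (S.homS R (Tr t) i j)}.Finite := by
  choose τ _ hτ using fun V : Subgroup (Gr j) => hTr V
  refine (Set.finite_range τ).subset fun t ht => ?_
  obtain ⟨n⟩ : Nonempty (Inj (Tr t) (Gr j)) :=
    ht.elim nonempty_inj_of_nontrivial_homS nonempty_inj_of_nontrivial_homS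
  exact ⟨n.1.range, (hτ n.1.range t ⟨(MonoidHom.ofInjective n.2).symm⟩).symm⟩

section Sigma

variable {𝒯 : Type*} {Tr : 𝒯 → Type u} [∀ t, Group (Tr t)]
  [∀ t, Finite (Tr t)]

open scoped TensorProduct

theorem sigmaR_tmul (r : R) (a : S.burnside i j) :
    S.sigmaR R Tr i j (r ⊗ₜ[ℤ] a) = r • S.sigma R Tr i j a := by
  simp [sigmaR]

theorem sigmaR_one_tmul (a : S.burnside i j) :
    S.sigmaR R Tr i j (1 ⊗ₜ[ℤ] a) = S.sigma R Tr i j a := by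
  rw [sigmaR_tmul, one_smul]

/-- The composite with the surjection `cosetCombination` is injective, which forces σ itself to be
injective; no basis of the source is required. -/
theorem sigmaR_injective_of_mulVec
    (hTr : ∀ (A : Type u) [Group A] [Finite A], ∃! t, Nonempty (A ≃* Tr t))
    [Fintype (S.TripleClass i j)]
    (h : Function.Injective ((S.markTable i j).map (Int.cast : ℤ → R)).mulVec) :
    Function.Injective (S.sigmaR R Tr i j) := by
  classical
  have h1 : Function.Injective
      (classCoeff hTr i j ∘ₗ S.sigmaR R Tr i j ∘ₗ cosetCombination R) := by
    rw [classCoeff_comp_sigmaR_comp]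
    exact h
  intro x y hxy
  obtain ⟨v, rfl⟩ := cosetCombination_surjective x
  obtain ⟨w, rfl⟩ := cosetCombination_surjective y
  exact congrArg _ (h1 (congrArg (classCoeff hTr i j) hxy))

theorem sigmaR_bijective
    (hTr : ∀ (A : Type u) [Group A] [Finite A], ∃! t, Nonempty (A ≃* Tr t))
    (hn : IsUnit (Nat.card (Gr i × Gr j) : R)) :
    Function.Bijective (S.sigmaR R Tr i j) := by
  classical
  have : Fintype (S.TripleClass i j) := Fintype.ofFinite _
  have hdet : IsUnit ((S.markTable i j).map (Int.cast : ℤ → R)).det := by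
    rw [show ((S.markTable i j).map (Int.cast : ℤ → R)).det = ((S.markTable i j).det : ℤ) from
      ((Int.castRingHom R).map_det _).symm]
    obtain ⟨N, hN⟩ := det_markTable_dvd (S := S) (i := i) (j := j)
    refine isUnit_of_dvd_unit ((Int.castRingHom R).map_dvd hN) ?_
    rw [map_pow]
    exact IsUnit.pow N (by simpa using hn)
  have hM := (Matrix.isUnit_iff_isUnit_det _).2 hdet
  refine ⟨sigmaR_injective_of_mulVec hTr (Matrix.mulVec_injective_of_isUnit hM), fun f => ?_⟩
  -- The preimage of `f` has the inverse table applied to its class coefficients as coordinates.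
  refine ⟨cosetCombination R (((S.markTable i j).map (Int.cast : ℤ → R))⁻¹.mulVec
    (classCoeff hTr i j f)), (classCoeff_bijective hTr).1 ?_⟩
  refine (LinearMap.congr_fun (classCoeff_comp_sigmaR_comp hTr) _).trans ?_
  rw [Matrix.mulVecLin_apply, Matrix.mulVec_mulVec, Matrix.mul_nonsing_inv _ hdet,
    Matrix.one_mulVec]

theorem sigma_injective
    (hTr : ∀ (A : Type u) [Group A] [Finite A], ∃! t, Nonempty (A ≃* Tr t)) :
    Function.Injective (S.sigma ℤ Tr i j) := by
  classical
  have : Fintype (S.TripleClass i j) := Fintype.ofFinite _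
  have h : Function.Injective (S.sigmaR ℤ Tr i j) := by
    refine sigmaR_injective_of_mulVec hTr fun v w hvw => sub_eq_zero.1 ?_
    refine Matrix.eq_zero_of_mulVec_eq_zero (det_markTable_ne_zero (S := S) (i := i) (j := j)) ?_
    rw [Matrix.mulVec_sub, sub_eq_zero]
    exact hvw
  intro a b hab
  have h1 := h ((sigmaR_one_tmul a).trans (hab.trans (sigmaR_one_tmul b).symm))
  simpa using congrArg (TensorProduct.lid ℤ (S.burnside i j)) h1

/-- The adjugate of the table shows that the determinant annihilates the cokernel. The codomain is
finitely generated, and a finitely generated torsion abelian group is finite. -/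
theorem finite_quotient_range_sigma
    (hTr : ∀ (A : Type u) [Group A] [Finite A], ∃! t, Nonempty (A ≃* Tr t)) :
    Finite ((∀ t, S.homS ℤ (Tr t) i j) ⧸ (S.sigma ℤ Tr i j).toAddMonoidHom.range) := by
  classical
  have : Fintype (S.TripleClass i j) := Fintype.ofFinite _
  have hfin : Module.Finite ℤ (∀ t, S.homS ℤ (Tr t) i j) :=
    Module.Finite.equiv (LinearEquiv.ofBijective _ (classCoeff_bijective hTr)).symm
  have hfg : AddGroup.FG (∀ t, S.homS ℤ (Tr t) i j) := Module.Finite.iff_addGroup_fg.1 hfin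
  have hdet := det_markTable_ne_zero (S := S) (i := i) (j := j)
  have key : ∀ f : ∀ t, S.homS ℤ (Tr t) i j,
      (S.markTable i j).det • f ∈ (S.sigma ℤ Tr i j).toAddMonoidHom.range := by
    intro f
    let x := cosetCombination ℤ ((S.markTable i j).adjugate.mulVec (classCoeff hTr i j f))
    have hx : S.sigmaR ℤ Tr i j x = (S.markTable i j).det • f := by
      refine (classCoeff_bijective hTr).1 ?_
      refine (LinearMap.congr_fun (classCoeff_comp_sigmaR_comp hTr) _).trans ?_
      change (S.markTable i j).mulVec _ = _
      rw [Matrix.mulVec_mulVec, Matrix.mul_adjugate, Matrix.smul_mulVec, Matrix.one_mulVec,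
        map_smul]
    refine ⟨TensorProduct.lid ℤ _ x, ?_⟩
    rw [← hx]
    refine (sigmaR_one_tmul _).symm.trans (congrArg _ ?_)
    exact (TensorProduct.lid ℤ _).symm_apply_apply x
  refine AddCommGroup.finite_of_fg_isAddTorsion _ ?_
  intro q
  obtain ⟨f, rfl⟩ := QuotientAddGroup.mk_surjective q
  refine isOfFinAddOrder_iff_zsmul_eq_zero.2 ⟨_, hdet, ?_⟩
  exact (QuotientAddGroup.eq_zero_iff _).2 (key f)

end Sigma

/-- A point `x` of the regular biset is fixed by all `(l(t), n(t))` exactly when conjugation by `x`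
takes `n` to `l`. There is no such point unless `[l] = [n]`, and for `l = n` these points form the
centralizer, so the coefficient is 1. -/
theorem sigmaT_one (T : Type u) [Group T] [Finite T] : S.sigmaT R T i i 1 = 1 := by
  classical
  refine homS_ext fun l n => ?_
  rw [sigmaT_apply]
  change ((markCoeff (l.triple n) (BurnsideGroup.cls (Biset.regular (Gr i))) : ℤ) : R) =
    (Finsupp.single n.bar (1 : R)) l.bar
  have hfix : ∀ (l : Inj T (Gr i)) (x : Gr i), (x ∈ MulAction.fixedPoints (l.triple n).graph
      (Biset.regular (Gr i)).carrier) ↔ x • n = l := by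
    intro l x
    refine (Inj.mem_fixedPoints_triple (X := (Biset.regular (Gr i)).carrier) l n x).trans ?_
    constructor
    · intro h
      refine Subtype.ext (MonoidHom.ext fun t => ?_)
      have h1 : l.1 t * x * (n.1 t)⁻¹ = x := h t
      change x * n.1 t * x⁻¹ = l.1 t
      rw [← mul_inv_eq_iff_eq_mul.1 h1, mul_inv_cancel_right]
    · rintro rfl t
      change x * n.1 t * x⁻¹ * x * (n.1 t)⁻¹ = x
      group
  by_cases h : l.bar = n.bar
  · rw [h, Finsupp.single_eq_same]
    -- Conjugation invariance of the coefficient reduces the case of equal orbits to `l = n`.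
    obtain ⟨g, rfl⟩ := Inj.bar_eq.1 h
    have h1 := Inj.triple_smul n n g 1
    rw [one_smul] at h1
    rw [h1, markCoeff_smul_triple, markCoeff, BurnsideGroup.mark_cls]
    have h2 : Nat.card (MulAction.fixedPoints (n.triple n).graph
        (Biset.regular (Gr i)).carrier) =
        Nat.card (Subgroup.centralizer (n.1.range : Set (Gr i))) := by
      rw [← Inj.stabilizer_eq]
      exact Nat.card_congr (Equiv.subtypeEquivRight fun x => hfix n x)
    rw [h2]
    refine (congrArg Int.cast (Int.ediv_self ?_)).trans Int.cast_one
    exact Nat.cast_ne_zero.2 Nat.card_pos.ne'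
  · rw [Finsupp.single_eq_of_ne h, markCoeff, BurnsideGroup.mark_cls]
    have : IsEmpty (MulAction.fixedPoints (l.triple n).graph (Biset.regular (Gr i)).carrier) :=
      ⟨fun x => h (Inj.bar_eq.2 ⟨x.1, (hfix l x.1).1 x.2⟩)⟩
    rw [Nat.card_of_isEmpty, Nat.cast_zero, Int.zero_ediv, Int.cast_zero]

end BifreeSystem

/-! ### σ as a ring and algebra homomorphism for `G = H` -/

namespace BifreeSystem

variable {ι : Type*} {Gr : ι → Type u} [∀ i, Group (Gr i)] [∀ i, Finite (Gr i)]
  {S : BifreeSystem Gr} {i j : ι}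

section Ring

variable {R : Type*} [CommRing R] {𝒯 : Type*} {Tr : 𝒯 → Type u} [∀ t, Group (Tr t)]
  [∀ t, Finite (Tr t)]

variable (S R Tr i) in
/-- The ring homomorphism `σ_{G,G}`. -/
noncomputable def sigmaRingHom : S.burnside i i →+* ∀ t, S.homS R (Tr t) i i where
  toFun a := S.sigma R Tr i i a
  map_one' := funext fun t => sigmaT_one (Tr t)
  map_mul' a b := funext fun t => Subtype.ext (sigmaT_bmul (Tr t) a b)
  map_zero' := map_zero _
  map_add' := map_add _

open scoped TensorProduct

variable (S R Tr i) in
/-- The algebra homomorphism `R B^𝒮(G, G) → ∏_T End^𝒮_{R Out(T)}(R Inj̄(T, G))`. -/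
noncomputable def sigmaAlgHom : R ⊗[ℤ] S.burnside i i →ₐ[R] ∀ t, S.homS R (Tr t) i i :=
  Algebra.TensorProduct.algHomOfLinearMapTensorProduct (S.sigmaR R Tr i i)
    (fun r s a b => by
      rw [sigmaR_tmul, sigmaR_tmul, sigmaR_tmul, smul_mul_smul_comm]
      exact congrArg _ ((sigmaRingHom S i R Tr).map_mul a b))
    ((sigmaR_one_tmul _).trans (sigmaRingHom S i R Tr).map_one)

end Ring

end BifreeSystem

/-! ### The ghost product and composition -/

section GhostProduct

variable {T G H K : Type u} [Group T] [Group G] [Group H] [Group K]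

/-- Take `n = α⁻¹ l`. Applied twice, this parametrises the factorisations of a triple by injections
into the middle group. -/
theorem IsoTriple.exists_eq_triple (t : IsoTriple G H) (l : Inj T G) (h : t.U = l.1.range) :
    ∃ n : Inj T H, t = l.triple n := by
  obtain ⟨U, V, α⟩ := t
  obtain rfl : U = l.1.range := h
  refine ⟨⟨V.subtype.comp (((MonoidHom.ofInjective l.2).trans α.symm).toMonoidHom),
    V.subtype_injective.comp ((MonoidHom.ofInjective l.2).trans α.symm).injective⟩,
    IsoTriple.graph_injective (Subgroup.ext fun p => ?_)⟩
  refine Iff.trans ?_ (Inj.mem_graph_triple _ _ _).symm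
  constructor
  · rintro ⟨h, rfl⟩
    refine ⟨(MonoidHom.ofInjective l.2).symm (α h), ?_⟩
    change (_, ((α.symm ((MonoidHom.ofInjective l.2) ((MonoidHom.ofInjective l.2).symm (α h))) :
      V) : H)) = _
    rw [MulEquiv.apply_symm_apply, MulEquiv.symm_apply_apply]
    refine Prod.ext ?_ rfl
    exact congrArg Subtype.val ((MonoidHom.ofInjective l.2).apply_symm_apply (α h))
  · rintro ⟨t, rfl⟩
    refine ⟨α.symm (MonoidHom.ofInjective l.2 t), ?_⟩
    refine Prod.ext ?_ rfl
    exact congrArg Subtype.val (α.apply_symm_apply (MonoidHom.ofInjective l.2 t))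

theorem Inj.triple_comp_triple (l : Inj T G) (m : Inj T H) (n : Inj T K)
    (h : (l.triple m).V = (m.triple n).U) : (l.triple m).comp (m.triple n) h = l.triple n := by
  refine IsoTriple.graph_injective (Subgroup.ext fun p => ?_)
  rw [Inj.mem_graph_triple]
  constructor
  · rintro ⟨x, rfl⟩
    obtain ⟨t, rfl⟩ := (MonoidHom.ofInjective n.2).surjective x
    refine ⟨t, Prod.ext ?_ rfl⟩
    change _ = (((MonoidHom.ofInjective l.2) ((MonoidHom.ofInjective m.2).symm
      ((MonoidHom.ofInjective m.2) ((MonoidHom.ofInjective n.2).symm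
        ((MonoidHom.ofInjective n.2) t))))) : G)
    rw [MulEquiv.symm_apply_apply, MulEquiv.symm_apply_apply]
    rfl
  · rintro ⟨t, rfl⟩
    refine ⟨MonoidHom.ofInjective n.2 t, Prod.ext ?_ rfl⟩
    change (((MonoidHom.ofInjective l.2) ((MonoidHom.ofInjective m.2).symm
      ((MonoidHom.ofInjective m.2) ((MonoidHom.ofInjective n.2).symm
        ((MonoidHom.ofInjective n.2) t))))) : G) = _
    rw [MulEquiv.symm_apply_apply, MulEquiv.symm_apply_apply]
    rfl

/-- With `l` fixed the ambiguity by `Aut(T)` disappears, since `l = l ∘ ω` forces `ω` to be trivial.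
-/
theorem Inj.triple_left_injective [Finite T] (l : Inj T G) :
    Function.Injective (l.triple : Inj T H → IsoTriple G H) := by
  intro m m' h
  obtain ⟨ω, h1, rfl⟩ := Inj.exists_comp_eq h
  refine Subtype.ext (MonoidHom.ext fun t => ?_)
  have h2 : l.1 t = l.1 (ω t) := congrArg (fun f : Inj T G => f.1 t) h1
  exact congrArg m.1 (l.2 h2)

open Classical in
theorem ghostMul_apply [Fintype (IsoTriple G H)] [Fintype (IsoTriple H K)]
    (a : IsoTriple G H →₀ ℚ) (b : IsoTriple H K →₀ ℚ) (u : IsoTriple G K) :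
    ghostMul G H K a b u = ∑ q : IsoTriple G H × IsoTriple H K,
      if ∃ h : q.1.V = q.2.U, q.1.comp q.2 h = u then
        a q.1 * b q.2 * ((Nat.card (Subgroup.centralizer (q.1.V : Set H)) : ℚ) / Nat.card H)
      else 0 := by
  rw [ghostMul, Finsupp.lift_apply, Finsupp.sum_fintype _ _ (by simp), Fintype.sum_prod_type,
    LinearMap.sum_apply, Finsupp.finsetSum_apply]
  refine Finset.sum_congr rfl fun s _ => ?_
  rw [LinearMap.smul_apply, Finsupp.lift_apply, Finsupp.sum_fintype _ _ (by simp),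
    Finsupp.smul_apply, Finsupp.finsetSum_apply, Finset.smul_sum]
  refine Finset.sum_congr rfl fun t _ => ?_
  rw [Finsupp.smul_apply, smul_eq_mul, smul_eq_mul, ← mul_assoc]
  by_cases h : s.V = t.U
  · rw [dif_pos h, Finsupp.single_apply]
    by_cases h' : s.comp t h = u
    · rw [if_pos h', if_pos ⟨h, h'⟩]
    · rw [if_neg h', mul_zero, if_neg fun ⟨_, h2⟩ => h' h2]
  · rw [dif_neg h, Finsupp.zero_apply, mul_zero, if_neg fun ⟨h1, _⟩ => h h1]

/-- The composable pairs with composite `l.triple n` are exactly `(l.triple m, m.triple n)`, one for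
each injection `m`. -/
theorem ghostMul_apply_triple [Finite G] [Finite H] [Finite K] [Finite T] [Fintype (Inj T H)]
    (a : IsoTriple G H →₀ ℚ) (b : IsoTriple H K →₀ ℚ) (l : Inj T G) (n : Inj T K) :
    ghostMul G H K a b (l.triple n) = ∑ m : Inj T H,
      (Nat.card (Subgroup.centralizer (m.1.range : Set H)) : ℚ) *
        (a (l.triple m) * b (m.triple n)) / Nat.card H := by
  classical
  have : Fintype (IsoTriple G H) := Fintype.ofFinite _
  have : Fintype (IsoTriple H K) := Fintype.ofFinite _
  rw [ghostMul_apply]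
  refine (Fintype.sum_of_injective (fun m : Inj T H => (l.triple m, m.triple n)) ?_ _ _ ?_ ?_).symm
  · exact fun m m' h => l.triple_left_injective (congrArg Prod.fst h)
  -- A contributing pair starts at `l(T)`, which yields `m`; its second factor starts at `m(T)`,
  -- which yields an injection that must be `n`.
  · rintro ⟨s, t⟩ hst
    refine if_neg ?_
    rintro ⟨h, e⟩
    obtain ⟨m, rfl⟩ := s.exists_eq_triple l (congrArg IsoTriple.U e)
    obtain ⟨n', rfl⟩ := t.exists_eq_triple m h.symm
    rw [Inj.triple_comp_triple] at e
    obtain rfl := l.triple_left_injective e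
    exact hst ⟨m, rfl⟩
  · intro m
    refine Eq.trans ?_ (if_pos ⟨rfl, Inj.triple_comp_triple l m n rfl⟩).symm
    change _ = _ * ((Nat.card (Subgroup.centralizer (m.1.range : Set H)) : ℚ) / Nat.card H)
    ring

end GhostProduct

/-! ### Compatibility of τ with products -/

namespace BifreeSystem

variable {ι : Type*} {Gr : ι → Type u} [∀ i, Group (Gr i)] [∀ i, Finite (Gr i)]
  {S : BifreeSystem Gr} {i j k : ι}

/-- Taking `c` as the preimage under τ of the composite makes integrality, invariance and support
automatic. It only remains to compare its coefficients with those of the rational product. -/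
theorem exists_ghostMul_eq (T : Type u) [Group T] [Finite T] (a : S.ghostT T i j)
    (b : S.ghostT T j k) : ∃ c : S.ghostT T i k,
      c.1.mapRange (Int.cast : ℤ → ℚ) Int.cast_zero =
        ghostMul (Gr i) (Gr j) (Gr k) (a.1.mapRange (Int.cast : ℤ → ℚ) Int.cast_zero)
          (b.1.mapRange (Int.cast : ℤ → ℚ) Int.cast_zero) ∧
      (S.tauT T i k c).1 = (S.tauT T i j a).1 ∘ₗ (S.tauT T j k b).1 := by
  classical
  have : Fintype (InjBar T (Gr j)) := Fintype.ofFinite _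
  have : Fintype (Inj T (Gr j)) := Fintype.ofFinite _
  have : Fintype (IsoTriple (Gr i) (Gr j)) := Fintype.ofFinite _
  have : Fintype (IsoTriple (Gr j) (Gr k)) := Fintype.ofFinite _
  obtain ⟨c, hc⟩ := (tauT_bijective T).2 ⟨(S.tauT T i j a).1 ∘ₗ (S.tauT T j k b).1,
    homS_comp (S.tauT T i j a).2 (S.tauT T j k b).2⟩
  have hc' := congrArg Subtype.val hc
  refine ⟨c, Finsupp.ext fun u => ?_, hc'⟩
  rw [Finsupp.mapRange_apply]
  by_cases hu : Nonempty (u.V ≃* T)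
  · obtain ⟨l, n, rfl⟩ := u.exists_triple_eq hu.some
    rw [ghostMul_apply_triple, ← tauT_apply, hc']
    change ((((S.tauT T i j a).1 ∘ₗ (S.tauT T j k b).1) (Finsupp.single n.bar 1) l.bar : ℤ) : ℚ) =
      _
    rw [homS_comp_apply, Int.cast_sum, ← Finset.sum_div]
    -- The weights of the ghost product are those of the passage from injections to orbits.
    have h := sum_card_centralizer_mul (A := ℚ) fun q : InjBar T (Gr j) =>
      (((S.tauT T i j a).1 (Finsupp.single q 1) l.bar *
        (S.tauT T j k b).1 (Finsupp.single n.bar 1) q : ℤ) : ℚ)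
    rw [eq_div_iff (Nat.cast_ne_zero.2 Nat.card_pos.ne'), mul_comm, ← h]
    refine Finset.sum_congr rfl fun m _ => ?_
    rw [tauT_apply, tauT_apply, Int.cast_mul]
    rfl
  -- Off type `T` both sides vanish: a composite has the same `V` as its second factor, where `b` is
  -- zero.
  · rw [ghostT_apply_eq_zero c fun h => hu h.2.2, Int.cast_zero, ghostMul_apply]
    refine (Finset.sum_eq_zero fun q _ => ?_).symm
    split_ifs with h
    · obtain ⟨h, rfl⟩ := h
      have hb : b.1 q.2 = 0 := ghostT_apply_eq_zero b fun h => hu h.2.2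
      rw [Finsupp.mapRange_apply, Finsupp.mapRange_apply, hb, Int.cast_zero, mul_zero, zero_mul]
    · rfl

end BifreeSystem

open scoped TensorProduct in
theorem theorem5p4
    {ι : Type*} (Gr : ι → Type u) [∀ i, Group (Gr i)] [∀ i, Finite (Gr i)]
    (S : BifreeSystem Gr)
    {𝒯 : Type*} (Tr : 𝒯 → Type u) [∀ t, Group (Tr t)] [∀ t, Finite (Tr t)]
    (hTr : ∀ (A : Type u) [Group A] [Finite A], ∃! t, Nonempty (A ≃* Tr t))
    (R : Type*) [CommRing R] (i j k : ι) :
    -- the maps `σ_T` turn the biset product into composition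
    (∀ (t : 𝒯) (a : S.burnside i j) (b : S.burnside j k),
      (S.sigmaT ℤ (Tr t) i k (S.bmul a b)).1 =
        (S.sigmaT ℤ (Tr t) i j a).1 ∘ₗ (S.sigmaT ℤ (Tr t) j k b).1) ∧
    -- the collection of the `σ_T`; all but finitely many factors vanish, so that the product
    -- of the homomorphism modules is their direct sum
    ({t : 𝒯 | Nontrivial (S.homS ℤ (Tr t) i j) ∨ Nontrivial (S.homS R (Tr t) i j)}.Finite ∧
      Function.Injective (S.sigma ℤ Tr i j) ∧
      Finite ((∀ t, S.homS ℤ (Tr t) i j) ⧸ (S.sigma ℤ Tr i j).toAddMonoidHom.range) ∧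
      (IsUnit (Nat.card (Gr i × Gr j) : R) → Function.Bijective (S.sigmaR R Tr i j))) ∧
    -- the case `G = H`: ring homomorphism and algebra isomorphism
    ((∃ φ : S.burnside i i →+* ∀ t, S.homS ℤ (Tr t) i i,
        (∀ a, φ a = S.sigma ℤ Tr i i a) ∧ Function.Injective φ ∧
        φ.toAddMonoidHom.range.FiniteIndex) ∧
      (IsUnit (Nat.card (Gr i) : R) →
        ∃ φ : R ⊗[ℤ] S.burnside i i ≃ₐ[R] ∀ t, S.homS R (Tr t) i i,
          ∀ x, φ x = S.sigmaR R Tr i i x)) ∧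
    -- the connecting maps `τ_T`
    ((∀ t : 𝒯, Function.Bijective (S.tauT (Tr t) i j)) ∧
      (∀ (t : 𝒯) (a : S.burnside i j),
        S.tauT (Tr t) i j (S.rhoT (Tr t) i j a) = S.sigmaT ℤ (Tr t) i j a) ∧
      (∀ a : S.burnside i j,
        (fun t => S.tauT (Tr t) i j (S.ghostProj (Tr t) i j (S.rho i j a))) =
          S.sigma ℤ Tr i j a) ∧
      (∀ (t : 𝒯) (a : S.ghostT (Tr t) i j) (b : S.ghostT (Tr t) j k),
        ∃ c : S.ghostT (Tr t) i k,
          c.1.mapRange (Int.cast : ℤ → ℚ) Int.cast_zero =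
            ghostMul (Gr i) (Gr j) (Gr k) (a.1.mapRange (Int.cast : ℤ → ℚ) Int.cast_zero)
              (b.1.mapRange (Int.cast : ℤ → ℚ) Int.cast_zero) ∧
          (S.tauT (Tr t) i k c).1 = (S.tauT (Tr t) i j a).1 ∘ₗ (S.tauT (Tr t) j k b).1)) := by
  refine ⟨fun t a b => BifreeSystem.sigmaT_bmul (Tr t) a b,
    ⟨BifreeSystem.finite_setOf_nontrivial_homS hTr, BifreeSystem.sigma_injective hTr,
      BifreeSystem.finite_quotient_range_sigma hTr, BifreeSystem.sigmaR_bijective hTr⟩,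
    ⟨⟨BifreeSystem.sigmaRingHom S i ℤ Tr, fun a => rfl, BifreeSystem.sigma_injective hTr, ?_⟩,
      fun h => ?_⟩,
    fun t => BifreeSystem.tauT_bijective (Tr t), fun t a => BifreeSystem.tauT_rhoT (Tr t) a,
    fun a => funext fun t => BifreeSystem.tauT_rhoT (Tr t) a,
    fun t a b => BifreeSystem.exists_ghostMul_eq (Tr t) a b⟩
  · exact @AddSubgroup.finiteIndex_of_finite_quotient _ _ _
      (BifreeSystem.finite_quotient_range_sigma (S := S) (i := i) (j := i) hTr)
  -- Here `|G × G| = |G|²`, so invertibility of `|G|` is enough.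
  · have hn : IsUnit (Nat.card (Gr i × Gr i) : R) := by
      rw [Nat.card_prod, Nat.cast_mul]
      exact h.mul h
    exact ⟨AlgEquiv.ofBijective (BifreeSystem.sigmaAlgHom S i R Tr)
      (BifreeSystem.sigmaR_bijective hTr hn), fun x => rfl⟩
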